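/- Let $R$ be an algebraically closed field and let $G$ be a locally profinite group with center $Z$ which has a compact open subgroup of invertible pro-order in $R$. Let $\pi$ be a smooth irreducible $R$-representation of $G$ which is $Z$-compact, i.e. all matrix coefficients $c_{\xi,v}: g \mapsto \xi(\pi(g)v)$ ($\xi\in\pi^\vee$, $v\in\pi$, where $\pi^\vee$ is the smooth contragredient) have compact support modulo $Z$, and which has a central character $\omega_\pi : Z \to R^\times$. Let $N$ be a closed subgroup of $G$ exhausted by compact subgroups of invertible pro-order in $R$ (every compact subset of $N$ lies in such a subgroup), with $ZN$ closed in $G$, and let $\theta : N \to R^\times$ be a smooth character. Assume that $\omega_\pi$ and $\theta$ agree on $Z\cap N$, so that $[\omega_\pi\theta](zn)=\omega_\pi(z)\theta(n)$ is a well-defined homomorphism $ZN\to R^\times$. For a closed subgroup $H$ of $G$ and a homomorphism $\chi : H \to R^\times$, let $\operatorname{ind}_H^G(\chi)$ be the space of functions $f: G\to R$ which are right invariant under some open subgroup, satisfy $f(hg)=\chi(h)f(g)$ for $h \in H$, and have compact support modulo $H$. The group $N\times G$ acts on $\operatorname{ind}_Z^G(\omega_\pi)$ and on $\operatorname{ind}_{ZN}^G([\omega_\pi\theta])$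 by $((\lambda\otimes\rho)(n,g)f)(x)=f(n^{-1}xg)$. For a representation $W$ of $N$ and a character $\chi$ of $N$ put $W[\chi]=\langle n\cdot w-\chi(n)w \mid n \in N,\ w \in W\rangle$ and $W_\chi=W/W[\chi]$. Let $c:\pi^\vee\otimes_R\pi\to\operatorname{ind}_Z^G(\omega_\pi)$ be the coefficient map $\xi\otimes v\mapsto c_{\xi,v}$. Then $[\omega_\pi\theta]$ is smooth if $N$ is $\sigma$-compact; there is a right invariant $R$-valued Haar measure (a nonzero right invariant linear form on locally constant compactly supported functions) on $Z\backslash ZN$; and for each such Haar measure there are morphisms of $(N\times G)$-representations $$q:\operatorname{ind}_Z^G(\omega_\pi)\twoheadrightarrow \operatorname{ind}_{ZN}^G([\omega_\pi\theta]),\qquad c_{\theta^{-1}}:(\pi^\vee)_{\theta^{-1}}\otimes_R\pi\hookrightarrow\operatorname{ind}_{ZN}^G([\omega_\pi\theta])$$ such that * $q$ is surjective and its kernel is $\operatorname{ind}_Z^G(\omega_\pi)[\theta^{-1}]$, for the action $\lambda$ of $N$; * if $[\omega_\pi\theta]$ is smooth, then $q(f)(g)=\int_{Z\backslash ZN}[\omega_\pi\theta]^{-1}(h)\,f(hg)\,dh$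 for all $f$ and $g$, the integrand being locally constant and compactly supported on $Z\backslash ZN$; * $c_{\theta^{-1}}$ is induced by the coefficient map, i.e. $c_{\theta^{-1}}(\bar\xi\otimes v)=q(c(\xi\otimes v))$ for all $\xi\in\pi^\vee$ and $v\in\pi$, where $\bar\xi$ is the class of $\xi$; * $c_{\theta^{-1}}$ is injective. -/

import Mathlib

open scoped TensorProduct

noncomputable section

namespace SmoothRep

/-- The pro-order of the profinite group `K` (the least common multiple of the indices of its
open subgroups, as a supernatural number) is invertible in `R`. -/
def HasInvertibleProOrder (R : Type*) [CommRing R] (K : Type*) [Group K] [TopologicalSpace K] :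
    Prop :=
  ∀ U : Subgroup K, IsOpen (U : Set K) → IsUnit ((U.index : ℕ) : R)

/-- `N` is exhausted by compact subgroups of invertible pro-order in `R`: every compact subset
of `N` lies in such a subgroup. -/
def IsExhausted (R : Type*) [CommRing R] (N : Type*) [Group N] [TopologicalSpace N] : Prop :=
  ∀ C : Set N, IsCompact C →
    ∃ K : Subgroup N, C ⊆ K ∧ IsCompact (K : Set N) ∧ HasInvertibleProOrder R K

/-- A character `H → Rˣ` is smooth if its kernel is open. -/
def IsSmoothChar {R : Type*} [CommRing R] {H : Type*} [Group H] [TopologicalSpace H]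
    (χ : H →* Rˣ) : Prop :=
  IsOpen (χ.ker : Set H)

theorem continuous_conj_inv {G : Type*} [Group G] [TopologicalSpace G] [IsTopologicalGroup G]
    (g : G) : Continuous (MulAut.conj g⁻¹).toMonoidHom := by
  change Continuous fun u => g⁻¹ * u * (g⁻¹)⁻¹
  fun_prop

section Representations

variable {R : Type*} [Field R] {G : Type*} [Group G] [TopologicalSpace G] [IsTopologicalGroup G]
  {V : Type*} [AddCommGroup V] [Module R V]

/-- The space of vectors fixed by some open subgroup, as a subrepresentation. -/
def smoothVectors (π : Representation R G V) : Subrepresentation π where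
  toSubmodule :=
    { carrier := {v | ∃ U : OpenSubgroup G, ∀ u ∈ U, π u v = v}
      add_mem' := by
        rintro v w ⟨U, hU⟩ ⟨U', hU'⟩
        refine ⟨U ⊓ U', fun u hu => ?_⟩
        rw [map_add, hU u hu.1, hU' u hu.2]
      zero_mem' := ⟨⊤, fun u _ => map_zero _⟩
      smul_mem' := by
        rintro c v ⟨U, hU⟩
        exact ⟨U, fun u hu => by rw [map_smul, hU u hu]⟩ }
  apply_mem_toSubmodule := by
    rintro g v ⟨U, hU⟩
    refine ⟨U.comap (MulAut.conj g⁻¹).toMonoidHom (continuous_conj_inv g), fun u hu => ?_⟩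
    have h : g⁻¹ * u * g ∈ U := by simpa using hu
    have h2 := hU _ h
    have h3 : u * g = g * (g⁻¹ * u * g) := by group
    rw [← Module.End.mul_apply, ← map_mul, h3, map_mul, Module.End.mul_apply, h2]

/-- `π` is smooth: every vector is fixed by some open subgroup. -/
def IsSmooth (π : Representation R G V) : Prop :=
  ∀ v, ∃ U : OpenSubgroup G, ∀ u ∈ U, π u v = v

/-- The space of the contragredient `π^∨`: the smooth linear forms on `V`. -/
abbrev ContragredientSpace (π : Representation R G V) : Type _ :=
  (smoothVectors π.dual).toSubmodule

/-- The contragredient `π^∨` of `π`. -/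
def contragredient (π : Representation R G V) : Representation R G (ContragredientSpace π) :=
  (smoothVectors π.dual).toRepresentation

/-- All matrix coefficients `g ↦ ξ (π g v)`, with `ξ` in `π^∨` and `v` in `π`, have compact
support modulo the center of `G`. -/
def IsZCompact (π : Representation R G V) : Prop :=
  ∀ (ξ : ContragredientSpace π) (v : V), ∃ C : Set G, IsCompact C ∧
    ∀ g, (ξ : Module.Dual R V) (π g v) ≠ 0 → ∃ z ∈ Subgroup.center G, ∃ c ∈ C, g = z * c

/-- The center of `G` acts on `V` through the character `ω`. -/
def IsCentralCharacter (π : Representation R G V) (ω : Subgroup.center G →* Rˣ) : Prop :=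
  ∀ (z : Subgroup.center G) (v : V), π z v = (ω z : R) • v

/-- The submodule `V[χ]` spanned by the `h • v - χ(h) v`. -/
def coinvKer {H : Type*} [Group H] (σ : Representation R H V) (χ : H →* Rˣ) : Submodule R V :=
  Submodule.span R {w | ∃ (h : H) (v : V), w = σ h v - (χ h : R) • v}

/-- The `χ`-coinvariants `V_χ = V / V[χ]`. -/
abbrev Coinv {H : Type*} [Group H] (σ : Representation R H V) (χ : H →* Rˣ) : Type _ :=
  V ⧸ coinvKer σ χ

theorem coinvKer_le_comap {H : Type*} [Group H] (σ : Representation R H V) (χ : H →* Rˣ)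
    (k : H) : coinvKer σ χ ≤ (coinvKer σ χ).comap (σ k) := by
  refine Submodule.span_le.2 ?_
  rintro _ ⟨h, v, rfl⟩
  refine Submodule.subset_span ⟨k * h * k⁻¹, σ k v, ?_⟩
  have h1 : (χ (k * h * k⁻¹) : R) = χ h := by
    congr 1
    rw [map_mul, map_mul, map_inv, mul_comm (χ k), mul_inv_cancel_right]
  rw [h1, map_sub, map_smul, ← Module.End.mul_apply, ← Module.End.mul_apply, ← map_mul, ← map_mul,
    inv_mul_cancel_right]

/-- The action of `H` on the `χ`-coinvariants. -/
def coinvRep {H : Type*} [Group H] (σ : Representation R H V) (χ : H →* Rˣ) :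
    Representation R H (Coinv σ χ) :=
  σ.quotient (coinvKer σ χ) (coinvKer_le_comap σ χ)

/-- The external tensor product, a representation of `H × G`. -/
def extTensor {H W : Type*} [Group H] [AddCommGroup W] [Module R W]
    (σ : Representation R H W) (π : Representation R G V) :
    Representation R (H × G) (W ⊗[R] V) :=
  Representation.tprod (σ.comp (MonoidHom.fst H G)) (π.comp (MonoidHom.snd H G))

end Representations

theorem exists_center_mul {G : Type*} [Group G] {N : Subgroup G} (x : ↥(Subgroup.center G ⊔ N)) :
    ∃ (z : Subgroup.center G) (n : N), (z : G) * n = x := by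
  obtain ⟨z, hz, n, hn, e⟩ := Subgroup.mem_sup_of_normal_left.1 x.2
  exact ⟨⟨z, hz⟩, ⟨n, hn⟩, e⟩

theorem mul_eq_of_center_mul_eq {R : Type*} [Field R] {G : Type*} [Group G]
    (ω : Subgroup.center G →* Rˣ) {N : Subgroup G} (θ : N →* Rˣ)
    (hagree : ∀ (g : G) (hZ : g ∈ Subgroup.center G) (hN : g ∈ N), ω ⟨g, hZ⟩ = θ ⟨g, hN⟩)
    (z z' : Subgroup.center G) (n n' : N) (e : (z : G) * n = z' * n') :
    ω z * θ n = ω z' * θ n' := by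
  have e1 : (z' : G)⁻¹ * z = n' * (n : G)⁻¹ := by
    rw [eq_mul_inv_iff_mul_eq, mul_assoc, e, inv_mul_cancel_left]
  have h1 : (z' : G)⁻¹ * z ∈ N := e1 ▸ N.mul_mem n'.2 (N.inv_mem n.2)
  have h2 := hagree _ (z'⁻¹ * z).2 h1
  have h3 : ω (z'⁻¹ * z) = θ (n' * n⁻¹) := h2.trans (congrArg θ (Subtype.ext e1))
  rw [map_mul, map_mul, map_inv, map_inv, inv_mul_eq_iff_eq_mul] at h3
  rw [h3, mul_assoc, inv_mul_cancel_right]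

/-- The character `[ω θ] (z n) = ω(z) θ(n)` of `Z N`, for characters `ω` of the center `Z` and
`θ` of `N` that agree on `Z ∩ N`. -/
def prodChar {R : Type*} [Field R] {G : Type*} [Group G]
    (ω : Subgroup.center G →* Rˣ) {N : Subgroup G} (θ : N →* Rˣ)
    (hagree : ∀ (g : G) (hZ : g ∈ Subgroup.center G) (hN : g ∈ N), ω ⟨g, hZ⟩ = θ ⟨g, hN⟩) :
    ↥(Subgroup.center G ⊔ N) →* Rˣ where
  toFun x := ω (exists_center_mul x).choose * θ (exists_center_mul x).choose_spec.choose
  map_one' := by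
    have h := mul_eq_of_center_mul_eq ω θ hagree _ 1 _ 1
      (((exists_center_mul 1).choose_spec.choose_spec).trans (by simp))
    rw [h, map_one, map_one, mul_one]
  map_mul' x y := by
    have hx := (exists_center_mul x).choose_spec.choose_spec
    have hy := (exists_center_mul y).choose_spec.choose_spec
    have hc := fun g => Subgroup.mem_center_iff.1 (exists_center_mul y).choose.2 g
    have h := mul_eq_of_center_mul_eq ω θ hagree _
      ((exists_center_mul x).choose * (exists_center_mul y).choose) _
      ((exists_center_mul x).choose_spec.choose * (exists_center_mul y).choose_spec.choose)
      (((exists_center_mul (x * y)).choose_spec.choose_spec).trans (by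
        refine (congrArg₂ (· * ·) hx hy).symm.trans ?_
        simp only [Subgroup.coe_mul]
        rw [mul_assoc, mul_assoc, ← mul_assoc _ ((exists_center_mul y).choose : G), hc,
          mul_assoc]))
    rw [h, map_mul, map_mul, mul_mul_mul_comm]

theorem prodChar_apply {R : Type*} [Field R] {G : Type*} [Group G]
    (ω : Subgroup.center G →* Rˣ) {N : Subgroup G} (θ : N →* Rˣ)
    (hagree : ∀ (g : G) (hZ : g ∈ Subgroup.center G) (hN : g ∈ N), ω ⟨g, hZ⟩ = θ ⟨g, hN⟩)
    (z : Subgroup.center G) (n : N) (x : ↥(Subgroup.center G ⊔ N)) (hx : (x : G) = z * n) :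
    prodChar ω θ hagree x = ω z * θ n :=
  mul_eq_of_center_mul_eq ω θ hagree _ _ _ _
    ((exists_center_mul x).choose_spec.choose_spec.trans hx)

section Induction

variable {R : Type*} [Field R] {G : Type*} [Group G] [TopologicalSpace G] [IsTopologicalGroup G]

/-- The space of the compact induction `ind_H^G(χ)`: functions `f : G → R` that are right
invariant under some open subgroup, satisfy `f (h g) = χ(h) f(g)` for `h` in `H`, and have compact
support modulo `H`. -/
def cInd (H : Subgroup G) (χ : H →* Rˣ) : Submodule R (G → R) where
  carrier := {f | (∃ U : OpenSubgroup G, ∀ g, ∀ u ∈ U, f (g * u) = f g) ∧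
    (∀ (h : H) (g : G), f (h * g) = χ h * f g) ∧
    ∃ C : Set G, IsCompact C ∧ ∀ g, f g ≠ 0 → ∃ h ∈ H, ∃ c ∈ C, g = h * c}
  add_mem' := by
    rintro f f' ⟨⟨U, hU⟩, he, C, hC, hs⟩ ⟨⟨U', hU'⟩, he', C', hC', hs'⟩
    refine ⟨⟨U ⊓ U', fun g u hu => ?_⟩, fun h g => ?_, C ∪ C', hC.union hC', fun g hg => ?_⟩
    · simp only [Pi.add_apply]
      rw [hU g u hu.1, hU' g u hu.2]
    · simp only [Pi.add_apply]
      rw [he, he', mul_add]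
    · by_cases h0 : f g = 0
      · have h1 : f' g ≠ 0 := fun h1 => hg (by simp [h0, h1])
        obtain ⟨h, hh, c, hc, e⟩ := hs' g h1
        exact ⟨h, hh, c, Or.inr hc, e⟩
      · obtain ⟨h, hh, c, hc, e⟩ := hs g h0
        exact ⟨h, hh, c, Or.inl hc, e⟩
  zero_mem' := ⟨⟨⊤, fun _ _ _ => rfl⟩, fun _ _ => by simp, ∅, isCompact_empty, fun g hg => by
    simp at hg⟩
  smul_mem' := by
    rintro a f ⟨⟨U, hU⟩, he, C, hC, hs⟩
    refine ⟨⟨U, fun g u hu => ?_⟩, fun h g => ?_, C, hC, fun g hg => hs g fun h0 => hg ?_⟩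
    · simp only [Pi.smul_apply]
      rw [hU g u hu]
    · simp only [Pi.smul_apply, smul_eq_mul]
      rw [he]
      ring
    · simp [h0]

/-- The action `((λ ⊗ ρ)(m, g) f)(x) = f (m⁻¹ x g)` of `M × G` on `ind_H^G(χ)`, for a subgroup
`M` of `G` that normalizes `H` and fixes `χ`. -/
def cIndRep (H : Subgroup G) (χ : H →* Rˣ) (M : Subgroup G)
    (hM : ∀ m : M, ∀ h : H, ∃ h' : H, (h' : G) = (m : G)⁻¹ * h * m ∧ χ h' = χ h) :
    Representation R (M × G) (cInd H χ) where
  toFun p :=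
    { toFun f := ⟨fun x => (f : G → R) ((p.1 : G)⁻¹ * x * p.2), by
        obtain ⟨f, ⟨U, hU⟩, he, C, hC, hs⟩ := f
        obtain ⟨m, g⟩ := p
        refine ⟨⟨U.comap (MulAut.conj g⁻¹).toMonoidHom (continuous_conj_inv g), fun x u hu => ?_⟩,
          fun h x => ?_, (fun c => (m : G) * c * g⁻¹) '' C,
          hC.image (by fun_prop), fun x hx => ?_⟩
        · have h1 : g⁻¹ * u * g ∈ U := by simpa using hu
          have h2 := hU ((m : G)⁻¹ * x * g) _ h1
          have h3 : (m : G)⁻¹ * x * g * (g⁻¹ * u * g) = (m : G)⁻¹ * (x * u) * g := by group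
          rw [h3] at h2
          exact h2
        · obtain ⟨h', e, e'⟩ := hM m h
          have h2 := he h' ((m : G)⁻¹ * x * g)
          have h3 : (h' : G) * ((m : G)⁻¹ * x * g) = (m : G)⁻¹ * (h * x) * g := by
            rw [e]; group
          rw [h3, e'] at h2
          exact h2
        · obtain ⟨h, hh, c, hc, e⟩ := hs _ hx
          obtain ⟨h', e', -⟩ := hM m⁻¹ ⟨h, hh⟩
          refine ⟨h', h'.2, _, ⟨c, hc, rfl⟩, ?_⟩
          have h3 : x = (m : G) * ((m : G)⁻¹ * x * g) * g⁻¹ := by group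
          rw [h3, e]
          simp only [e', InvMemClass.coe_inv]
          group⟩
      map_add' _ _ := rfl
      map_smul' _ _ := rfl }
  map_one' := by
    ext f x
    simp
  map_mul' p q := by
    ext f x
    simp [mul_assoc]

/-- The action of `N × G` on `ind_Z^G(ω)` by `λ ⊗ ρ`, where `Z` is the center of `G`. -/
def indCenterRep (ω : Subgroup.center G →* Rˣ) (N : Subgroup G) :
    Representation R (N × G) (cInd (Subgroup.center G) ω) :=
  cIndRep (Subgroup.center G) ω N fun m h => ⟨h, by
    rw [mul_assoc, ← Subgroup.mem_center_iff.1 h.2 m, inv_mul_cancel_left], rfl⟩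

/-- The action of `N × G` on `ind_{ZN}^G(χ)` by `λ ⊗ ρ`. -/
def indProdRep {N : Subgroup G} (χ : ↥(Subgroup.center G ⊔ N) →* Rˣ) :
    Representation R (N × G) (cInd (Subgroup.center G ⊔ N) χ) :=
  cIndRep (Subgroup.center G ⊔ N) χ N fun m h =>
    ⟨⟨m, Subgroup.mem_sup_right m.2⟩⁻¹ * h * ⟨m, Subgroup.mem_sup_right m.2⟩, rfl, by
      rw [map_mul, map_mul, map_inv, mul_comm _ (χ h), inv_mul_cancel_right]⟩

/-- The coefficient map `π^∨ ⊗ π → ind_Z^G(ω)`, which sends `ξ ⊗ v` to `g ↦ ξ (π g v)`. -/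
def coeffMap {V : Type*} [AddCommGroup V] [Module R V] (π : Representation R G V)
    (hsm : IsSmooth π) (hZc : IsZCompact π) (ω : Subgroup.center G →* Rˣ)
    (hω : IsCentralCharacter π ω) :
    ContragredientSpace π ⊗[R] V →ₗ[R] cInd (Subgroup.center G) ω :=
  TensorProduct.lift (LinearMap.mk₂ R
    (fun ξ v => ⟨fun g => (ξ : Module.Dual R V) (π g v), by
      refine ⟨?_, fun z g => ?_, hZc ξ v⟩
      · obtain ⟨U, hU⟩ := hsm v
        exact ⟨U, fun g u hu => by beta_reduce; rw [map_mul, Module.End.mul_apply, hU u hu]⟩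
      · beta_reduce
        rw [map_mul, Module.End.mul_apply, hω, map_smul, smul_eq_mul]⟩)
    (fun _ _ _ => rfl) (fun _ _ _ => rfl)
    (fun _ _ _ => by ext; simp) (fun _ _ _ => by ext; simp))

end Induction

section Haar

variable (R : Type*) [Field R] (Q : Type*) [Group Q] [TopologicalSpace Q]

/-- The space `C_c^∞(Q)` of locally constant, compactly supported functions `Q → R`. -/
def locConstCc : Submodule R (Q → R) where
  carrier := {f | IsLocallyConstant f ∧ HasCompactSupport f}
  add_mem' hf hg := ⟨hf.1.add hg.1, hf.2.add hg.2⟩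
  zero_mem' := ⟨IsLocallyConstant.const 0, HasCompactSupport.zero⟩
  smul_mem' a _ hf := ⟨hf.1.comp (a • ·), hf.2.comp_left (smul_zero a)⟩

variable {R Q}

/-- `μ` is a right invariant `R`-valued Haar measure on `Q`: a nonzero linear form on
`C_c^∞(Q)` invariant under right translation. -/
structure IsHaar (μ : locConstCc R Q →ₗ[R] R) : Prop where
  ne_zero : μ ≠ 0
  right_invariant : ∀ (q : Q) (φ ψ : locConstCc R Q),
    (∀ x, (ψ : Q → R) x = (φ : Q → R) (x * q)) → μ ψ = μ φ

end Haar

/-- The group `Z \ Z N`, where `Z` is the center of `G`. -/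
abbrev ModCenter {G : Type*} [Group G] (N : Subgroup G) : Type _ :=
  ↥(Subgroup.center G ⊔ N) ⧸ (Subgroup.center G).subgroupOf (Subgroup.center G ⊔ N)

end SmoothRep

end

open SmoothRep

noncomputable section

/-! Write χ = [ωθ]. On a group Q with a compact open subgroup K of invertible pro-order, dividing
sums over U \ Q by the index of U in K gives an R-valued Haar measure (`exists_isHaar`), and every
Haar measure is nonzero on such a K. For Q = Z \ ZN, integrating χ⁻¹(h) f(hg) defines q. It commutes
with N because a right Haar measure is left invariant under every element of a compact subgroup
(`IsHaar.left_invariant`), and N is exhausted by such subgroups.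

To study q, cut a function that is right invariant under a small U into its pieces on the cosets
ZaU. A piece that is χ-equivariant along ZN has integral at a equal to its value times the volume of
a compact open subgroup, and this volume is invertible. Such pieces give surjectivity. Modulo
ind(ω)[θ⁻¹], the pieces of f inside one ZNaU are proportional to each other. So f can be reduced
until it is χ-equivariant within one coset along each ZN-orbit, and then q(f) = 0 forces f = 0
(`mem_coinvKer_of_integrationMap_eq_zero`). If χ is not smooth, the target and the θ⁻¹-coinvariants
of the source both vanish.

Injectivity rests on two facts. First, the coefficient map is injective: Z-compactness makes the
U-coinvariants of π finite-dimensional, hence Schur's lemma, and Jacobson density then separates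
independent vectors (`coeffLift_injective`). Second, averaging over compact subgroups of N shows
that passing to coinvariants preserves injectivity (`mem_coinvKer_of_injective`). Since ker q is
exactly the [θ⁻¹]-part, the induced map is injective.

Smoothness of χ for σ-compact N comes from the open mapping theorem for N → Z \ ZN. -/

namespace SmoothRep

open Topology Pointwise

/-! ### Open subgroups and invertible pro-orders -/

section Groups

variable {G : Type*} [Group G] [TopologicalSpace G]

/-- Every neighbourhood of `1` contains an open subgroup. -/
def HasOpenSubgroupBasis (G : Type*) [Group G] [TopologicalSpace G] : Prop :=
  ∀ s ∈ 𝓝 (1 : G), ∃ U : OpenSubgroup G, (U : Set G) ⊆ s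

/-- All relative indices in `K` of open subgroups of the ambient group are invertible in `R`. -/
def HasInvertibleIndices (R : Type*) [CommRing R] (K : Subgroup G) : Prop :=
  ∀ U : Subgroup G, IsOpen (U : Set G) → IsUnit ((U.relIndex K : ℕ) : R)

theorem HasInvertibleProOrder.hasInvertibleIndices {R : Type*} [CommRing R] {K : Subgroup G}
    (h : HasInvertibleProOrder R K) : HasInvertibleIndices R K := fun U hU =>
  h (U.subgroupOf K) (hU.preimage continuous_subtype_val)

theorem isUnit_natCast_of_dvd {R : Type*} [CommRing R] {m n : ℕ} (h : m ∣ n)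
    (hn : IsUnit (n : R)) : IsUnit (m : R) :=
  isUnit_of_dvd_unit (Nat.cast_dvd_cast h) hn

theorem HasOpenSubgroupBasis.subgroup (h : HasOpenSubgroupBasis G) (M : Subgroup G) :
    HasOpenSubgroupBasis M := by
  intro s hs
  rw [nhds_subtype_eq_comap] at hs
  obtain ⟨t, ht, hts⟩ := hs
  obtain ⟨U, hU⟩ := h t ht
  exact ⟨U.comap M.subtype continuous_subtype_val, fun x hx => hts (hU hx)⟩

theorem HasInvertibleIndices.quotient {R : Type*} [CommRing R] {K : Subgroup G}
    (h : HasInvertibleIndices R K) (Z : Subgroup G) [Z.Normal] :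
    HasInvertibleIndices R (K.map (QuotientGroup.mk' Z)) := by
  intro V hV
  have := h (V.comap (QuotientGroup.mk' Z)) (hV.preimage QuotientGroup.continuous_mk)
  rwa [Subgroup.relIndex_comap] at this

variable [IsTopologicalGroup G]

/-- The intersection of all K-conjugates of U works: compactness of K and the tube lemma keep it
open. -/
theorem exists_openSubgroup_normalized {K : Subgroup G} (hK : IsCompact (K : Set G))
    (U : OpenSubgroup G) :
    ∃ W : OpenSubgroup G, W ≤ U ∧ ∀ k ∈ K, ∀ w ∈ W, k * w * k⁻¹ ∈ W := by
  let W : Subgroup G :=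
    { carrier := {w | ∀ k ∈ K, k * w * k⁻¹ ∈ U}
      mul_mem' := fun {a b} ha hb k hk => by
        have := U.mul_mem (ha k hk) (hb k hk)
        simpa [mul_assoc] using this
      one_mem' := fun k _ => by simp
      inv_mem' := fun {a} ha k hk => by
        have := U.inv_mem (ha k hk)
        simpa [mul_assoc] using this }
  have hopen : IsOpen ((fun p : G × G => p.1 * p.2 * p.1⁻¹) ⁻¹' (U : Set G)) :=
    U.isOpen.preimage (by fun_prop)
  obtain ⟨S, T, -, hT, hKS, h1T, hST⟩ := generalized_tube_lemma hK
    (isCompact_singleton (x := (1 : G))) hopen (by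
      rintro ⟨k, x⟩ ⟨-, rfl⟩
      simp)
  have hW : IsOpen (W : Set G) := W.isOpen_of_mem_nhds (g := 1)
    (Filter.mem_of_superset (hT.mem_nhds (h1T rfl)) fun t ht k hk => hST (Set.mk_mem_prod (hKS hk) ht))
  refine ⟨⟨W, hW⟩, fun w hw => by simpa using hw 1 K.one_mem, fun k hk w hw k' hk' => ?_⟩
  have := hw (k' * k) (K.mul_mem hk' hk)
  simpa [mul_assoc] using this

/-- Relative indices need not divide each other in general. Shrinking U to a W normalized by K makes
W ∩ K normal in K, and then [L : W ∩ L] divides [K : W ∩ K]. -/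
theorem HasInvertibleIndices.mono {R : Type*} [CommRing R] {K L : Subgroup G}
    (h : HasInvertibleIndices R K) (hK : IsCompact (K : Set G)) (hLK : L ≤ K) :
    HasInvertibleIndices R L := by
  intro U hU
  obtain ⟨W, hWU, hW⟩ := exists_openSubgroup_normalized hK ⟨U, hU⟩
  have : ((W : Subgroup G).subgroupOf K).Normal :=
    ⟨fun w hw k => Subgroup.mem_subgroupOf.2 (hW k k.2 w (Subgroup.mem_subgroupOf.1 hw))⟩
  refine isUnit_natCast_of_dvd ?_ (h W W.isOpen)
  refine (Subgroup.relIndex_dvd_of_le_left L (show (W : Subgroup G) ≤ U from hWU)).trans ?_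
  have h2 := ((W : Subgroup G).subgroupOf K).relIndex_dvd_index_of_normal (L.subgroupOf K)
  rwa [Subgroup.relIndex_subgroupOf hLK] at h2

theorem exists_compact_hasInvertibleIndices {R : Type*} [CommRing R] {K : Subgroup G}
    (hKo : IsOpen (K : Set G)) (hK : IsCompact (K : Set G)) (h : HasInvertibleIndices R K)
    (U : OpenSubgroup G) :
    ∃ W : OpenSubgroup G, W ≤ U ∧ IsCompact (W : Set G) ∧ HasInvertibleIndices R (W : Subgroup G) :=
  ⟨U ⊓ ⟨K, hKo⟩, inf_le_left, hK.of_isClosed_subset (OpenSubgroup.isClosed _)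
    fun _ hx => hx.2, h.mono hK fun _ hx => hx.2⟩

theorem hasOpenSubgroupBasis_of_compact_open [TotallyDisconnectedSpace G]
    {K : Subgroup G} (hKo : IsOpen (K : Set G)) (hK : IsCompact (K : Set G)) :
    HasOpenSubgroupBasis G := by
  intro s hs
  have : CompactSpace K := isCompact_iff_compactSpace.1 hK
  obtain ⟨t, hts, hto, h1t⟩ := mem_nhds_iff.1 hs
  obtain ⟨H, hH⟩ := ProfiniteGrp.exist_openNormalSubgroup_sub_open_nhds_of_one (G := K)
    (hto.preimage continuous_subtype_val) h1t
  refine ⟨⟨H.toSubgroup.map K.subtype, ?_⟩, ?_⟩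
  · exact hKo.isOpenMap_subtype_val _ H.isOpen'
  · rintro _ ⟨x, hx, rfl⟩
    exact hts (hH hx)

theorem HasOpenSubgroupBasis.quotient (h : HasOpenSubgroupBasis G) (Z : Subgroup G) [Z.Normal] :
    HasOpenSubgroupBasis (G ⧸ Z) := by
  intro s hs
  obtain ⟨U, hU⟩ := h ((QuotientGroup.mk' Z) ⁻¹' s)
    (QuotientGroup.continuous_mk.continuousAt.preimage_mem_nhds hs)
  refine ⟨⟨(U : Subgroup G).map (QuotientGroup.mk' Z), ?_⟩, ?_⟩
  · exact QuotientGroup.isOpenMap_coe _ U.isOpen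
  · rintro _ ⟨x, hx, rfl⟩
    exact hU hx

theorem HasInvertibleIndices.subgroupOf {R : Type*} [CommRing R] {K : Subgroup G}
    (h : HasInvertibleIndices R K) (hK : IsCompact (K : Set G)) (hb : HasOpenSubgroupBasis G)
    (M : Subgroup G) : HasInvertibleIndices R (K.subgroupOf M) := by
  intro V hV
  obtain ⟨O, hO, e⟩ := isOpen_induced_iff.1 hV
  obtain ⟨W, hW⟩ := hb O (hO.mem_nhds (show (1 : M) ∈ Subtype.val ⁻¹' O from e ▸ V.one_mem))
  have hWV : (W : Subgroup G).comap M.subtype ≤ V := fun x hx =>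
    show x ∈ (V : Set M) from e ▸ hW hx
  refine isUnit_natCast_of_dvd (Subgroup.relIndex_dvd_of_le_left _ hWV) ?_
  rw [Subgroup.relIndex_comap]
  refine h.mono hK ?_ W W.isOpen
  rintro _ ⟨x, hx, rfl⟩
  exact hx

theorem HasInvertibleIndices.conj {R : Type*} [CommRing R] {K : Subgroup G}
    (h : HasInvertibleIndices R K) (g : G) :
    HasInvertibleIndices R (K.map (MulAut.conj g).toMonoidHom) := by
  intro U hU
  have := h (U.comap (MulAut.conj g).toMonoidHom) (hU.preimage (by
    simpa using continuous_conj_inv g⁻¹))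
  rwa [Subgroup.relIndex_comap] at this

theorem exists_openSubgroup_mul_left (hb : HasOpenSubgroupBasis G) {α : Type*} {f : G → α}
    (hf : IsLocallyConstant f) {C : Set G} (hC : IsCompact C) :
    ∃ U : OpenSubgroup G, ∀ u ∈ U, ∀ c ∈ C, f (u * c) = f c := by
  -- With the discrete topology on the values, the condition f(uc) = f(c) is open in (u, c), and the
  -- tube lemma applies to {1} × C.
  let _ : TopologicalSpace α := ⊥
  have : DiscreteTopology α := ⟨rfl⟩
  have hopen : IsOpen {p : G × G | f (p.1 * p.2) = f p.2} := by
    have h1 : Continuous fun p : G × G => (f (p.1 * p.2), f p.2) :=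
      (hf.continuous.comp (by fun_prop)).prodMk (hf.continuous.comp (by fun_prop))
    exact (isOpen_discrete {q : α × α | q.1 = q.2}).preimage h1
  obtain ⟨S, T, hS, -, h1S, hCT, hST⟩ := generalized_tube_lemma
    (isCompact_singleton (x := (1 : G))) hC hopen (by
      rintro ⟨k, x⟩ ⟨rfl, -⟩
      simp)
  obtain ⟨U, hU⟩ := hb S (hS.mem_nhds (h1S rfl))
  exact ⟨U, fun u hu c hc => hST (Set.mk_mem_prod (hU hu) (hCT hc))⟩

end Groups

/-! ### Sums over U \ Q -/

section CosetSum

variable {Q : Type*} [Group Q]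

/-- Left invariance of a function under a subgroup. -/
def IsLeftInvariant {R : Type*} (U : Subgroup Q) (φ : Q → R) : Prop :=
  ∀ u ∈ U, ∀ x, φ (u * x) = φ x

theorem IsLeftInvariant.mono {R : Type*} {U V : Subgroup Q} {φ : Q → R} (h : IsLeftInvariant U φ)
    (hVU : V ≤ U) : IsLeftInvariant V φ :=
  fun u hu => h u (hVU hu)

/-- Inversion identifies U \ Q with `Q ⧸ U`; this makes the sum independent of the chosen
representatives. -/
theorem IsLeftInvariant.apply_out_inv {R : Type*} {U : Subgroup Q} {φ : Q → R} (h : IsLeftInvariant U φ)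
    (x : Q) : φ (x : Q ⧸ U).out⁻¹ = φ x⁻¹ := by
  obtain ⟨u, hu⟩ := QuotientGroup.mk_out_eq_mul U x
  rw [hu, mul_inv_rev]
  exact h _ (U.inv_mem u.2) _

variable {R : Type*} [Field R]

/-- The sum over `U \ Q` of a left `U`-invariant function. -/
def cosetSum (U : Subgroup Q) (φ : Q → R) : R :=
  ∑ᶠ y : Q ⧸ U, φ y.out⁻¹

theorem finite_support_apply_out_inv [TopologicalSpace Q] [IsTopologicalGroup Q]
    {U : Subgroup Q} {φ : Q → R} (hU : IsOpen (U : Set Q))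
    (hφ : HasCompactSupport φ) : (Function.support fun y : Q ⧸ U => φ y.out⁻¹).Finite := by
  have : DiscreteTopology (Q ⧸ U) := QuotientGroup.discreteTopology hU
  have hc : IsCompact ((fun x : Q => ((x⁻¹ : Q) : Q ⧸ U)) '' tsupport φ) :=
    hφ.isCompact.image (QuotientGroup.continuous_mk.comp continuous_inv)
  refine (hc.finite_of_discrete).subset fun y hy => ?_
  exact ⟨y.out⁻¹, subset_tsupport _ hy, by simp⟩

theorem cosetSum_mul_right {U : Subgroup Q} {φ : Q → R} (h : IsLeftInvariant U φ) (q : Q) :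
    cosetSum U (fun x => φ (x * q)) = cosetSum U φ := by
  refine finsum_eq_of_bijective (fun y : Q ⧸ U => q⁻¹ • y)
    (MulAction.toPerm (α := Q) (β := Q ⧸ U) q⁻¹).bijective fun y => ?_
  obtain ⟨x, rfl⟩ := QuotientGroup.mk_surjective y
  have h' : IsLeftInvariant U fun x => φ (x * q) := fun u hu x => by
    beta_reduce
    rw [mul_assoc, h u hu]
  have e : q⁻¹ • (x : Q ⧸ U) = ((q⁻¹ * x : Q) : Q ⧸ U) := rfl
  beta_reduce
  rw [e, h.apply_out_inv, show φ (_ * q) = _ from h'.apply_out_inv x, mul_inv_rev, inv_inv]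

/-- Since n normalizes U, right multiplication by n permutes `Q ⧸ U`, and φ(n⁻¹x⁻¹) = φ((xn)⁻¹). -/
theorem cosetSum_mul_left {U : Subgroup Q} {φ : Q → R} (h : IsLeftInvariant U φ) (n : Q)
    (hn : ∀ u ∈ U, n * u * n⁻¹ ∈ U) (hn' : ∀ u ∈ U, n⁻¹ * u * n ∈ U) :
    cosetSum U (fun x => φ (n⁻¹ * x)) = cosetSum U φ := by
  have hr : ∀ m : Q, (∀ u ∈ U, m⁻¹ * u * m ∈ U) → ∀ a b : Q,
      QuotientGroup.leftRel U a b → QuotientGroup.leftRel U (a * m) (b * m) := by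
    intro m hm a b hab
    rw [QuotientGroup.leftRel_apply] at hab ⊢
    simpa [mul_assoc] using hm _ hab
  let e : Q ⧸ U ≃ Q ⧸ U :=
    { toFun := Quotient.map (· * n) (hr n hn')
      invFun := Quotient.map (· * n⁻¹) (hr n⁻¹ (by simpa using hn))
      left_inv := fun y => by
        obtain ⟨x, rfl⟩ := QuotientGroup.mk_surjective y
        exact congrArg (QuotientGroup.mk (s := U)) (mul_inv_cancel_right x n)
      right_inv := fun y => by
        obtain ⟨x, rfl⟩ := QuotientGroup.mk_surjective y
        exact congrArg (QuotientGroup.mk (s := U)) (inv_mul_cancel_right x n) }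
  refine finsum_eq_of_bijective e e.bijective fun y => ?_
  obtain ⟨x, rfl⟩ := QuotientGroup.mk_surjective y
  have h' : IsLeftInvariant U fun x => φ (n⁻¹ * x) := fun u hu x => by
    have := h _ (hn' u hu) (n⁻¹ * x)
    beta_reduce
    rw [← this]
    congr 1
    group
  have e1 : e (x : Q ⧸ U) = ((x * n : Q) : Q ⧸ U) := rfl
  beta_reduce
  rw [e1, h.apply_out_inv, show φ (n⁻¹ * _) = _ from h'.apply_out_inv x, mul_inv_rev]

theorem cosetSum_eq_relIndex_mul {U V : Subgroup Q} (hVU : V ≤ U) (hfin : V.relIndex U ≠ 0)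
    {φ : Q → R} (h : IsLeftInvariant U φ)
    (hs : (Function.support fun y : Q ⧸ U => φ y.out⁻¹).Finite) :
    cosetSum V φ = (V.relIndex U : R) * cosetSum U φ := by
  have : Finite (U ⧸ V.subgroupOf U) := by
    have : (V.subgroupOf U).FiniteIndex := ⟨hfin⟩
    infer_instance
  let e := Subgroup.quotientEquivProdOfLE hVU
  have h1 : cosetSum V φ = ∑ᶠ p : (Q ⧸ U) × (U ⧸ V.subgroupOf U), φ p.1.out⁻¹ := by
    refine finsum_eq_of_bijective e e.bijective fun y => ?_
    obtain ⟨x, rfl⟩ := QuotientGroup.mk_surjective y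
    have e1 : (e (x : Q ⧸ V)).1 = (x : Q ⧸ U) := rfl
    rw [e1, h.apply_out_inv, (h.mono hVU).apply_out_inv]
  rw [h1, finsum_curry]
  · have h2 : ∀ a : Q ⧸ U, ∑ᶠ _ : U ⧸ V.subgroupOf U, φ a.out⁻¹
        = (V.relIndex U : R) * φ a.out⁻¹ := fun a => by
      have := Fintype.ofFinite (U ⧸ V.subgroupOf U)
      rw [finsum_eq_sum_of_fintype, Finset.sum_const, nsmul_eq_mul, Finset.card_univ,
        ← Nat.card_eq_fintype_card]
      rfl
    simp only [h2]
    rw [cosetSum, mul_finsum' _ _]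
    exact hs
  · refine (hs.prod (Set.finite_univ (α := U ⧸ V.subgroupOf U))).subset fun p hp => ⟨hp, trivial⟩

end CosetSum

/-! ### Existence and invariance of Haar measures -/

section HaarMeasure

variable {R : Type*} [Field R] {Q : Type*} [Group Q] [TopologicalSpace Q] [IsTopologicalGroup Q]

theorem exists_isLeftInvariant (hb : HasOpenSubgroupBasis Q) (φ : locConstCc R Q) :
    ∃ U : OpenSubgroup Q, IsLeftInvariant (U : Subgroup Q) (φ : Q → R) := by
  obtain ⟨U, hU⟩ := exists_openSubgroup_mul_left hb φ.2.1 φ.2.2.isCompact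
  refine ⟨U, fun u hu x => ?_⟩
  by_cases hx : x ∈ tsupport (φ : Q → R)
  · exact hU u hu x hx
  by_cases hux : u * x ∈ tsupport (φ : Q → R)
  -- If only ux lies in the support, invariance is read backwards from ux by u⁻¹.
  · have := hU u⁻¹ (U.inv_mem hu) _ hux
    rwa [inv_mul_cancel_left, eq_comm] at this
  · rw [image_eq_zero_of_notMem_tsupport hx, image_eq_zero_of_notMem_tsupport hux]

open Classical in
/-- The indicator function of a compact open subgroup. -/
def subgroupIndicator (R : Type*) [Field R] (U : OpenSubgroup Q) (hU : IsCompact (U : Set Q)) :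
    locConstCc R Q :=
  ⟨fun x => if x ∈ U then 1 else 0, by
    refine ⟨?_, HasCompactSupport.of_support_subset_isCompact hU fun x hx => ?_⟩
    · convert (LocallyConstant.charFn R U.isClopen).isLocallyConstant using 1
      ext x
      simp [LocallyConstant.coe_charFn, Set.indicator_apply]
    · by_contra h
      exact hx (if_neg h)⟩

open Classical in
theorem subgroupIndicator_apply (U : OpenSubgroup Q) (hU : IsCompact (U : Set Q)) (x : Q) :
    (subgroupIndicator R U hU : Q → R) x = if x ∈ U then 1 else 0 := rfl

theorem subgroupIndicator_isLeftInvariant (U : OpenSubgroup Q) (hU : IsCompact (U : Set Q)) :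
    IsLeftInvariant (U : Subgroup Q) (subgroupIndicator R U hU : Q → R) := fun u hu x => by
  rw [subgroupIndicator_apply, subgroupIndicator_apply,
    show u * x ∈ U ↔ x ∈ U from Subgroup.mul_mem_cancel_left _ hu]

theorem cosetSum_subgroupIndicator (U : OpenSubgroup Q) (hU : IsCompact (U : Set Q)) :
    cosetSum (U : Subgroup Q) (subgroupIndicator R U hU : Q → R) = 1 := by
  have h := subgroupIndicator_isLeftInvariant (R := R) U hU
  rw [cosetSum, finsum_eq_single _ ((1 : Q) : Q ⧸ (U : Subgroup Q)), h.apply_out_inv,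
    subgroupIndicator_apply, if_pos (by simp)]
  intro y hy
  obtain ⟨x, rfl⟩ := QuotientGroup.mk_surjective y
  rw [h.apply_out_inv, subgroupIndicator_apply, if_neg]
  intro hx
  refine hy ((QuotientGroup.eq).2 ?_)
  simpa using hx

/-- Right translation of compactly supported locally constant functions. -/
def translateRight (q : Q) (φ : locConstCc R Q) : locConstCc R Q :=
  ⟨fun x => (φ : Q → R) (x * q), φ.2.1.comp_continuous (by fun_prop),
    φ.2.2.comp_homeomorph (Homeomorph.mulRight q)⟩

/-- φ is a finite combination of right translates of the indicator of U, all of which have the same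
measure. -/
theorem apply_eq_mul_cosetSum {μ : locConstCc R Q →ₗ[R] R} (hμ : IsHaar μ) (U : OpenSubgroup Q)
    (hU : IsCompact (U : Set Q)) (φ : locConstCc R Q)
    (hφ : IsLeftInvariant (U : Subgroup Q) (φ : Q → R)) :
    μ φ = μ (subgroupIndicator R U hU) * cosetSum (U : Subgroup Q) (φ : Q → R) := by
  have hs := finite_support_apply_out_inv U.isOpen φ.2.2
  have h1 : φ = ∑ y ∈ hs.toFinset, (φ : Q → R) y.out⁻¹ •
      translateRight y.out (subgroupIndicator R U hU) := by
    ext x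
    rw [Submodule.coe_sum, Finset.sum_apply, Finset.sum_eq_single ((x⁻¹ : Q) : Q ⧸ (U : Subgroup Q))]
    · rw [hφ.apply_out_inv, inv_inv]
      obtain ⟨u, hu⟩ := QuotientGroup.mk_out_eq_mul (U : Subgroup Q) x⁻¹
      change _ = _ * (subgroupIndicator R U hU : Q → R) (x * _)
      rw [subgroupIndicator_apply, hu, if_pos, mul_one]
      rw [mul_inv_cancel_left]
      exact u.2
    · intro y _ hy
      change _ * (subgroupIndicator R U hU : Q → R) (x * _) = 0
      rw [subgroupIndicator_apply, if_neg, mul_zero]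
      intro hx
      refine hy ?_
      rw [← QuotientGroup.out_eq' y, eq_comm, QuotientGroup.eq, inv_inv]
      exact hx
    · intro hy
      have : (φ : Q → R) ((x⁻¹ : Q) : Q ⧸ (U : Subgroup Q)).out⁻¹ = 0 := by simpa using hy
      rw [this, zero_smul]; rfl
  have h2 : ∀ q, μ (translateRight q (subgroupIndicator R U hU)) = μ (subgroupIndicator R U hU) :=
    fun q => hμ.right_invariant q _ _ fun _ => rfl
  conv_lhs => rw [h1]
  rw [map_sum, cosetSum, finsum_eq_sum_of_support_subset _ (s := hs.toFinset) (by simp),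
    Finset.mul_sum]
  exact Finset.sum_congr rfl fun y _ => by rw [map_smul, h2, smul_eq_mul, mul_comm]

/-- The volume of K is [K : V] times that of a smaller V, with [K : V] invertible. If K had volume
zero, so would every small V, and then μ would vanish. -/
theorem IsHaar.apply_subgroupIndicator_ne_zero (hb : HasOpenSubgroupBasis Q)
    {μ : locConstCc R Q →ₗ[R] R} (hμ : IsHaar μ) (K : OpenSubgroup Q)
    (hK : IsCompact (K : Set Q)) (hinv : HasInvertibleIndices R (K : Subgroup Q)) :
    μ (subgroupIndicator R K hK) ≠ 0 := by
  intro h0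
  refine hμ.ne_zero (LinearMap.ext fun φ => ?_)
  obtain ⟨U, hU⟩ := exists_isLeftInvariant hb φ
  have hV : IsCompact ((U ⊓ K : OpenSubgroup Q) : Set Q) :=
    hK.of_isClosed_subset (OpenSubgroup.isClosed _) fun _ hx => hx.2
  have hle : ((U ⊓ K : OpenSubgroup Q) : Subgroup Q) ≤ K := fun _ hx => hx.2
  have hu := hinv _ (U ⊓ K).isOpen
  have hKi := subgroupIndicator_isLeftInvariant (R := R) K hK
  have h1 := apply_eq_mul_cosetSum hμ (U ⊓ K) hV (subgroupIndicator R K hK) (hKi.mono hle)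
  rw [h0, cosetSum_eq_relIndex_mul hle (fun h => by rw [h] at hu; simp at hu) hKi
    (finite_support_apply_out_inv K.isOpen (subgroupIndicator R K hK).2.2),
    cosetSum_subgroupIndicator, mul_one] at h1
  have h2 := (mul_eq_zero.1 h1.symm).resolve_right hu.ne_zero
  rw [apply_eq_mul_cosetSum hμ (U ⊓ K) hV φ (hU.mono fun _ hx => hx.1), h2, zero_mul]
  rfl

/-- The modulus is trivial on compact subgroups: arbitrarily small compact open subgroups W are
normalized by n, and the sum over W \ Q does not see left translation by n. -/
theorem IsHaar.left_invariant (hb : HasOpenSubgroupBasis Q) {μ : locConstCc R Q →ₗ[R] R}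
    (hμ : IsHaar μ) (K₀ : OpenSubgroup Q) (hK₀ : IsCompact (K₀ : Set Q)) {K : Subgroup Q}
    (hK : IsCompact (K : Set Q)) {n : Q} (hn : n ∈ K) (φ ψ : locConstCc R Q)
    (h : ∀ x, (ψ : Q → R) x = (φ : Q → R) (n⁻¹ * x)) : μ ψ = μ φ := by
  obtain ⟨U, hU⟩ := exists_isLeftInvariant hb φ
  obtain ⟨W, hWU, hW⟩ := exists_openSubgroup_normalized hK (U ⊓ K₀)
  have hWc : IsCompact (W : Set Q) :=
    hK₀.of_isClosed_subset (OpenSubgroup.isClosed _) fun _ hx => (hWU hx).2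
  have hφ : IsLeftInvariant (W : Subgroup Q) (φ : Q → R) := hU.mono fun _ hx => (hWU hx).1
  have hn' : ∀ w ∈ W, n⁻¹ * w * n ∈ W := fun w hw => by
    simpa using hW n⁻¹ (K.inv_mem hn) w hw
  have hψ : IsLeftInvariant (W : Subgroup Q) (ψ : Q → R) := fun w hw x => by
    rw [h, h, ← hφ _ (hn' w hw) (n⁻¹ * x)]
    group
  rw [apply_eq_mul_cosetSum hμ W hWc ψ hψ, apply_eq_mul_cosetSum hμ W hWc φ hφ,
    ← cosetSum_mul_left hφ n (hW n hn) hn', funext h]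

theorem exists_isHaar (hb : HasOpenSubgroupBasis Q) (K : OpenSubgroup Q)
    (hK : IsCompact (K : Set Q)) (hinv : HasInvertibleIndices R (K : Subgroup Q)) :
    ∃ μ : locConstCc R Q →ₗ[R] R, IsHaar μ := by
  -- The factor gives K volume 1 and makes the value independent of U once φ is left U-invariant, by
  -- multiplicativity of indices.
  let m : OpenSubgroup Q → (Q → R) → R := fun U φ =>
    ((U : Subgroup Q).relIndex K : R)⁻¹ * cosetSum (U : Subgroup Q) φ
  have hne : ∀ U : OpenSubgroup Q, ((U : Subgroup Q).relIndex K : R) ≠ 0 := fun U =>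
    (hinv U U.isOpen).ne_zero
  have hm_le : ∀ (U V : OpenSubgroup Q) (φ : locConstCc R Q), V ≤ U → U ≤ K →
      IsLeftInvariant (U : Subgroup Q) (φ : Q → R) → m V φ = m U φ := by
    intro U V φ hVU hUK hφ
    have h1 : (V : Subgroup Q).relIndex U * (U : Subgroup Q).relIndex K =
        (V : Subgroup Q).relIndex K := Subgroup.relIndex_mul_relIndex _ _ _ hVU hUK
    have h2 := hne V
    rw [← h1, Nat.cast_mul] at h2
    have h3 := left_ne_zero_of_mul h2
    simp only [m]
    rw [cosetSum_eq_relIndex_mul (show (V : Subgroup Q) ≤ U from hVU)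
      (fun h => h3 (by rw [h, Nat.cast_zero])) hφ (finite_support_apply_out_inv U.isOpen φ.2.2), ← h1,
      Nat.cast_mul]
    field_simp [h3, hne U]
  have hm : ∀ (U V : OpenSubgroup Q) (φ : locConstCc R Q), U ≤ K → V ≤ K →
      IsLeftInvariant (U : Subgroup Q) (φ : Q → R) →
      IsLeftInvariant (V : Subgroup Q) (φ : Q → R) → m U φ = m V φ := by
    intro U V φ hU hV hφU hφV
    rw [← hm_le U (U ⊓ V) φ inf_le_left hU hφU, ← hm_le V (U ⊓ V) φ inf_le_right hV hφV]
  have hex : ∀ φ : locConstCc R Q, ∃ U : OpenSubgroup Q, U ≤ K ∧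
      IsLeftInvariant (U : Subgroup Q) (φ : Q → R) := fun φ => by
    obtain ⟨U, hU⟩ := exists_isLeftInvariant hb φ
    exact ⟨U ⊓ K, inf_le_right, hU.mono fun _ hx => hx.1⟩
  choose S hSK hS using hex
  have hmS : ∀ (U : OpenSubgroup Q) (φ : locConstCc R Q), U ≤ K →
      IsLeftInvariant (U : Subgroup Q) (φ : Q → R) → m (S φ) φ = m U φ := fun U φ hU hφ =>
    hm _ _ φ (hSK φ) hU (hS φ) hφ
  let μ : locConstCc R Q →ₗ[R] R :=
    { toFun := fun φ => m (S φ) φ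
      map_add' := fun φ ψ => by
        have h1 : IsLeftInvariant ((S φ ⊓ S ψ : OpenSubgroup Q) : Subgroup Q) (φ : Q → R) :=
          (hS φ).mono fun _ hx => hx.1
        have h2 : IsLeftInvariant ((S φ ⊓ S ψ : OpenSubgroup Q) : Subgroup Q) (ψ : Q → R) :=
          (hS ψ).mono fun _ hx => hx.2
        have hK' : S φ ⊓ S ψ ≤ K := inf_le_left.trans (hSK φ)
        rw [hmS (S φ ⊓ S ψ) (φ + ψ) hK' fun u hu x => congrArg₂ (· + ·) (h1 u hu x) (h2 u hu x),
          hmS _ φ hK' h1, hmS _ ψ hK' h2]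
        simp only [m]
        rw [← mul_add, cosetSum, cosetSum, cosetSum, ← finsum_add_distrib
          (finite_support_apply_out_inv (OpenSubgroup.isOpen _) φ.2.2)
          (finite_support_apply_out_inv (OpenSubgroup.isOpen _) ψ.2.2)]
        rfl
      map_smul' := fun a φ => by
        rw [hmS (S φ) (a • φ) (hSK φ) fun u hu x => congrArg (a * ·) (hS φ u hu x)]
        simp only [m]
        rw [RingHom.id_apply, smul_eq_mul, mul_left_comm, cosetSum, cosetSum, mul_finsum' _ _
          (finite_support_apply_out_inv (S φ).isOpen φ.2.2)]
        rfl }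
  refine ⟨μ, fun h => ?_, fun q φ ψ h => ?_⟩
  · have h1 : μ (subgroupIndicator R K hK) = m K (subgroupIndicator R K hK : Q → R) :=
      hmS K _ le_rfl (subgroupIndicator_isLeftInvariant K hK)
    simp only [m] at h1
    rw [h, cosetSum_subgroupIndicator, Subgroup.relIndex_self] at h1
    simp at h1
  · have h1 : μ ψ = m (S φ) ψ := hmS _ _ (hSK φ) fun u hu x => by
      rw [h, h, mul_assoc, hS φ u hu]
    rw [h1]
    simp only [m]
    rw [funext h, cosetSum_mul_right (hS φ)]
    rfl

end HaarMeasure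

/-! ### Cosets modulo the center -/

theorem isLocallyConstant_of_mul_right {G : Type*} [Group G] [TopologicalSpace G]
    [IsTopologicalGroup G] {α : Type*} {f : G → α} (U : OpenSubgroup G)
    (h : ∀ g, ∀ u ∈ U, f (g * u) = f g) : IsLocallyConstant f := by
  refine (IsLocallyConstant.iff_eventually_eq f).2 fun x => ?_
  have hU : ∀ᶠ y in 𝓝 x, x⁻¹ * y ∈ (U : Set G) := by
    refine (continuous_const_mul x⁻¹).continuousAt.eventually_mem (U.isOpen.mem_nhds ?_)
    simp
  filter_upwards [hU] with y hy
  simpa using h x _ hy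

theorem mem_center_sup_iff {G : Type*} [Group G] {U : Subgroup G} {x : G} :
    x ∈ Subgroup.center G ⊔ U ↔ ∃ z ∈ Subgroup.center G, ∃ u ∈ U, x = z * u := by
  rw [Subgroup.mem_sup_of_normal_left]
  exact ⟨fun ⟨z, hz, u, hu, e⟩ => ⟨z, hz, u, hu, e.symm⟩,
    fun ⟨z, hz, u, hu, e⟩ => ⟨z, hz, u, hu, e.symm⟩⟩

/-- As Z is central, the double coset ZaU is the left coset of a modulo ZU, so these sets partition
G. -/
theorem inv_mul_mem_center_sup_iff {G : Type*} [Group G] {U : Subgroup G} {a x : G} :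
    a⁻¹ * x ∈ Subgroup.center G ⊔ U ↔ ∃ z ∈ Subgroup.center G, ∃ u ∈ U, x = z * a * u := by
  rw [mem_center_sup_iff]
  refine exists_congr fun z => and_congr_right fun hz => exists_congr fun u =>
    and_congr_right fun _ => ?_
  rw [inv_mul_eq_iff_eq_mul, ← mul_assoc, Subgroup.mem_center_iff.1 hz a]

theorem locConstCc_ext {R : Type*} [Field R] {G : Type*} [Group G] [TopologicalSpace G]
    {N : Subgroup G} {φ ψ : locConstCc R (ModCenter N)}
    (h : ∀ x : ↥(Subgroup.center G ⊔ N), (φ : ModCenter N → R) x = (ψ : ModCenter N → R) x) :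
    φ = ψ :=
  Subtype.ext (funext fun y => by
    obtain ⟨x, rfl⟩ := QuotientGroup.mk_surjective y
    exact h x)

/-! ### Integration along Z \ ZN -/

section Integration

variable {R : Type*} [Field R] {G : Type*} [Group G] [TopologicalSpace G] [IsTopologicalGroup G]
  {ω : Subgroup.center G →* Rˣ} {N : Subgroup G} {χ : ↥(Subgroup.center G ⊔ N) →* Rˣ}

/-- The character `χ` of `Z N` extends the character `ω` of the center. -/
def ExtendsCentral (ω : Subgroup.center G →* Rˣ) {N : Subgroup G}
    (χ : ↥(Subgroup.center G ⊔ N) →* Rˣ) : Prop :=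
  ∀ z : Subgroup.center G, χ ⟨z, Subgroup.mem_sup_left z.2⟩ = ω z

/-- The function `h ↦ χ(h)⁻¹ f (h g)` on `Z \ Z N`. -/
def integrand (hχ : ExtendsCentral ω χ)
    (hM : IsClosed ((Subgroup.center G ⊔ N : Subgroup G) : Set G)) (hs : IsSmoothChar χ)
    (f : cInd (Subgroup.center G) ω) (g : G) : locConstCc R (ModCenter N) :=
  ⟨Quotient.lift (fun h : ↥(Subgroup.center G ⊔ N) => ((χ h)⁻¹ : Rˣ) * (f : G → R) (h * g)) (by
      intro a b hab
      obtain ⟨z, hz, e⟩ : ∃ z : G, ∃ hz : z ∈ Subgroup.center G,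
          b = ⟨z, Subgroup.mem_sup_left hz⟩ * a := by
        have h1 := QuotientGroup.leftRel_apply.1 hab
        rw [Subgroup.mem_subgroupOf] at h1
        refine ⟨_, h1, Subtype.ext ?_⟩
        have := Subgroup.mem_center_iff.1 h1 a
        simp only [Subgroup.coe_mul, InvMemClass.coe_inv] at this ⊢
        rw [← this]
        group
      have h2 := f.2.2.1 ⟨z, hz⟩ (a * g)
      rw [e, map_mul, hχ ⟨z, hz⟩, Subgroup.coe_mul]
      dsimp only at h2 ⊢
      rw [mul_assoc, h2]
      simp only [mul_inv_rev, Units.val_mul, mul_assoc, Units.inv_mul_cancel_left]), by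
    refine ⟨fun s => ?_, ?_⟩
    -- Local constancy is tested on ZN, where the function is right invariant under ker χ ∩ gUg⁻¹.
    -- Smoothness of χ is used here.
    · refine isQuotientMap_quotient_mk'.isOpen_preimage.1 ?_
      obtain ⟨U, hU⟩ := f.2.1
      refine isLocallyConstant_of_mul_right (f := fun h : ↥(Subgroup.center G ⊔ N) =>
        ((χ h)⁻¹ : Rˣ) * (f : G → R) (h * g)) (⟨χ.ker, hs⟩ ⊓
          (U.comap (MulAut.conj g⁻¹).toMonoidHom (continuous_conj_inv g)).comap
          (Subgroup.subtype _) continuous_subtype_val) (fun h u hu => ?_) s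
      have h1 : χ u = 1 := hu.1
      have h2 : g⁻¹ * u * g ∈ U := by
        have : g⁻¹ * u * (g⁻¹)⁻¹ ∈ U := hu.2
        simpa using this
      have h3 := hU (h * g) _ h2
      have h4 : (h : G) * g * (g⁻¹ * u * g) = h * u * g := by group
      rw [h4] at h3
      rw [map_mul, h1, mul_one, Subgroup.coe_mul, h3]
    · obtain ⟨C, hC, hfC⟩ := f.2.2.2
      -- Closedness of ZN makes its intersection with Cg⁻¹ compact; the image of this intersection
      -- contains the support.
      have hC' : IsCompact ((↑) ⁻¹' ((fun c => c * g⁻¹) '' C) : Set ↥(Subgroup.center G ⊔ N)) :=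
        hM.isClosedEmbedding_subtypeVal.isCompact_preimage (hC.image (by fun_prop))
      refine HasCompactSupport.of_support_subset_isCompact
        (hC'.image QuotientGroup.continuous_mk) fun y hy => ?_
      obtain ⟨h, rfl⟩ := QuotientGroup.mk_surjective y
      obtain ⟨z, hz, c, hc, e⟩ := hfC (h * g) (right_ne_zero_of_mul hy)
      refine ⟨⟨z, Subgroup.mem_sup_left hz⟩⁻¹ * h, ⟨c, hc, ?_⟩, ?_⟩
      · simp only [Subgroup.coe_mul, InvMemClass.coe_inv]
        rw [mul_inv_eq_iff_eq_mul, mul_assoc, e, inv_mul_cancel_left]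
      · rw [eq_comm, QuotientGroup.eq, Subgroup.mem_subgroupOf]
        have := Subgroup.mem_center_iff.1 (Subgroup.inv_mem _ hz) h
        simp only [Subgroup.coe_mul, InvMemClass.coe_inv]
        rw [← this, inv_mul_cancel_left]
        exact Subgroup.inv_mem _ hz⟩

variable (hχ : ExtendsCentral ω χ)
  (hM : IsClosed ((Subgroup.center G ⊔ N : Subgroup G) : Set G)) (hs : IsSmoothChar χ)

theorem integrand_mk (f : cInd (Subgroup.center G) ω) (g : G) (h : ↥(Subgroup.center G ⊔ N)) :
    (integrand hχ hM hs f g : ModCenter N → R) h = ((χ h)⁻¹ : Rˣ) * (f : G → R) (h * g) :=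
  rfl

/-- Integration along `Z \ Z N`, from `ind_Z^G(ω)` to `ind_{ZN}^G(χ)`. -/
def integrationMap {μ : locConstCc R (ModCenter N) →ₗ[R] R} (hμ : IsHaar μ) :
    cInd (Subgroup.center G) ω →ₗ[R] cInd (Subgroup.center G ⊔ N) χ where
  toFun f := ⟨fun g => μ (integrand hχ hM hs f g), by
    refine ⟨?_, fun h g => ?_, ?_⟩
    · obtain ⟨U, hU⟩ := f.2.1
      refine ⟨U, fun g u hu => congrArg μ (locConstCc_ext fun h => ?_)⟩
      rw [integrand_mk, integrand_mk, ← mul_assoc, hU _ u hu]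
    · beta_reduce
      refine Eq.trans ?_ (μ.map_smul (χ h : R) _)
      -- The integrand at hg is χ(h) times the right translate by h of the integrand at g.
      refine hμ.right_invariant h _ _ fun y => ?_
      obtain ⟨y, rfl⟩ := QuotientGroup.mk_surjective y
      rw [← QuotientGroup.mk_mul, integrand_mk, ← mul_assoc]
      change _ = (χ h : R) * ((((χ (y * h))⁻¹ : Rˣ) : R) * _)
      rw [map_mul, mul_inv_rev, Units.val_mul, Subgroup.coe_mul, mul_assoc,
        mul_assoc ((χ h)⁻¹ : Rˣ).val, Units.mul_inv_cancel_left]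
    · obtain ⟨C, hC, hfC⟩ := f.2.2.2
      refine ⟨C, hC, fun g hg => ?_⟩
      obtain ⟨h, hh⟩ : ∃ h : ↥(Subgroup.center G ⊔ N), (f : G → R) (h * g) ≠ 0 := by
        by_contra! hall
        refine hg ?_
        have : integrand hχ hM hs f g = 0 := locConstCc_ext fun h => by
          rw [integrand_mk, hall h, mul_zero]; rfl
        beta_reduce
        rw [this, map_zero]
      obtain ⟨z, hz, c, hc, e⟩ := hfC _ hh
      refine ⟨h⁻¹ * z, Subgroup.mul_mem _ (Subgroup.inv_mem _ h.2) (Subgroup.mem_sup_left hz),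
        c, hc, ?_⟩
      rw [mul_assoc, ← e, InvMemClass.coe_inv, inv_mul_cancel_left]⟩
  map_add' f f' := by
    ext g
    change μ _ = μ _ + μ _
    rw [← map_add]
    exact congrArg μ (locConstCc_ext fun h => mul_add _ _ _)
  map_smul' a f := by
    ext g
    change μ _ = a * μ _
    rw [← smul_eq_mul, ← map_smul]
    exact congrArg μ (locConstCc_ext fun h => mul_left_comm _ _ _)

theorem integrationMap_apply {μ : locConstCc R (ModCenter N) →ₗ[R] R} (hμ : IsHaar μ)
    (f : cInd (Subgroup.center G) ω) (g : G) :
    (integrationMap hχ hM hs hμ f : G → R) g = μ (integrand hχ hM hs f g) := rfl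


/-- This is the equivariance of q. Translating f by n translates the integrand on the left, where
invariance is available only because n lies in a compact subgroup of N, whose image in Z \ ZN is
compact. -/
theorem integrationMap_apply_left_mul (hb : HasOpenSubgroupBasis (ModCenter N))
    (K₀ : OpenSubgroup (ModCenter N)) (hK₀ : IsCompact (K₀ : Set (ModCenter N)))
    (hNex : IsExhausted R N) {μ : locConstCc R (ModCenter N) →ₗ[R] R} (hμ : IsHaar μ)
    (n : N) (f f' : cInd (Subgroup.center G) ω) (g : G)
    (h : ∀ x, (f' : G → R) x = (f : G → R) ((n : G)⁻¹ * x * g)) (x : G) :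
    (integrationMap hχ hM hs hμ f' : G → R) x =
      (integrationMap hχ hM hs hμ f : G → R) ((n : G)⁻¹ * x * g) := by
  let n' : ↥(Subgroup.center G ⊔ N) := ⟨n, Subgroup.mem_sup_right n.2⟩
  have h1 : (integrationMap hχ hM hs hμ f : G → R) ((n : G)⁻¹ * x * g) =
      ((χ n')⁻¹ : Rˣ) * (integrationMap hχ hM hs hμ f : G → R) (x * g) := by
    have := (integrationMap hχ hM hs hμ f).2.2.1 n'⁻¹ (x * g)
    rw [map_inv] at this
    rw [← this, mul_assoc]
    rfl
  obtain ⟨K, hnK, hK, -⟩ := hNex {n} isCompact_singleton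
  let ι : N →* ModCenter N := (QuotientGroup.mk' _).comp 
    (Subgroup.inclusion (le_sup_right : N ≤ Subgroup.center G ⊔ N))
  have hι : Continuous ι := QuotientGroup.continuous_mk.comp (continuous_subtype_val.subtype_mk _)
  have hKQ : IsCompact ((K.map ι : Subgroup (ModCenter N)) : Set (ModCenter N)) := hK.image hι
  rw [h1, integrationMap_apply, integrationMap_apply, ← smul_eq_mul, ← map_smul]
  refine hμ.left_invariant hb K₀ hK₀ hKQ (Subgroup.mem_map_of_mem ι (hnK rfl)) _ _ fun y => ?_
  obtain ⟨y, rfl⟩ := QuotientGroup.mk_surjective y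
  change _ = (((χ n')⁻¹ : Rˣ) : R) * ((((χ (n'⁻¹ * y))⁻¹ : Rˣ) : R) *
    (f : G → R) ((n : G)⁻¹ * y * (x * g)))
  rw [integrand_mk, h, map_mul, mul_inv_rev, map_inv, inv_inv, mul_comm _ (χ n'), Units.val_mul,
    mul_assoc (χ n' : R), Units.inv_mul_cancel_left]
  simp only [mul_assoc]

open Classical in
/-- The function that agrees with `F` on `Z a U` and vanishes elsewhere. -/
def restrictCoset (U : OpenSubgroup G) (hU : IsCompact (U : Set G)) (F : G → R)
    (hF : ∀ g, ∀ u ∈ U, F (g * u) = F g)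
    (hFω : ∀ (z : Subgroup.center G) (g : G), F (z * g) = ω z * F g) (a : G) :
    cInd (Subgroup.center G) ω :=
  ⟨fun x => if a⁻¹ * x ∈ Subgroup.center G ⊔ (U : Subgroup G) then F x else 0, by
    refine ⟨⟨U, fun g u hu => ?_⟩, fun z g => ?_, (a * ·) '' U, hU.image (by fun_prop),
      fun g hg => ?_⟩
    · have : a⁻¹ * (g * u) ∈ Subgroup.center G ⊔ (U : Subgroup G) ↔
          a⁻¹ * g ∈ Subgroup.center G ⊔ (U : Subgroup G) := by
        rw [← mul_assoc]
        exact Subgroup.mul_mem_cancel_right _ (Subgroup.mem_sup_right hu)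
      beta_reduce
      rw [if_congr this (hF g u hu) rfl]
    · have : a⁻¹ * (z * g) ∈ Subgroup.center G ⊔ (U : Subgroup G) ↔
          a⁻¹ * g ∈ Subgroup.center G ⊔ (U : Subgroup G) := by
        rw [← mul_assoc, Subgroup.mem_center_iff.1 z.2, mul_assoc]
        exact Subgroup.mul_mem_cancel_left _ (Subgroup.mem_sup_left z.2)
      beta_reduce
      rw [if_congr this (hFω z g) rfl, mul_ite, mul_zero]
    · obtain ⟨z, hz, u, hu, e⟩ := inv_mul_mem_center_sup_iff.1
        (not_imp_comm.1 (fun h => if_neg h) hg)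
      exact ⟨z, hz, a * u, ⟨u, hu, rfl⟩, by rw [e, mul_assoc]⟩⟩

theorem restrictCoset_of_mem {U : OpenSubgroup G} {hU : IsCompact (U : Set G)} {F : G → R}
    {hF : ∀ g, ∀ u ∈ U, F (g * u) = F g}
    {hFω : ∀ (z : Subgroup.center G) (g : G), F (z * g) = ω z * F g} {a x : G}
    (h : a⁻¹ * x ∈ Subgroup.center G ⊔ (U : Subgroup G)) :
    (restrictCoset U hU F hF hFω a : G → R) x = F x :=
  if_pos h

theorem restrictCoset_of_notMem {U : OpenSubgroup G} {hU : IsCompact (U : Set G)} {F : G → R}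
    {hF : ∀ g, ∀ u ∈ U, F (g * u) = F g}
    {hFω : ∀ (z : Subgroup.center G) (g : G), F (z * g) = ω z * F g} {a x : G}
    (h : a⁻¹ * x ∉ Subgroup.center G ⊔ (U : Subgroup G)) :
    (restrictCoset U hU F hF hFω a : G → R) x = 0 :=
  if_neg h

/-- The image in `Z \ Z N` of `a U a⁻¹ ∩ Z N`. -/
def conjImage (N : Subgroup G) (U : OpenSubgroup G) (a : G) : OpenSubgroup (ModCenter N) :=
  ⟨(((U : Subgroup G).map (MulAut.conj a).toMonoidHom).subgroupOf
      (Subgroup.center G ⊔ N)).map (QuotientGroup.mk' _), by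
    have h : IsOpenMap fun x : G => a * x * a⁻¹ :=
      (isOpenMap_mul_right a⁻¹).comp (isOpenMap_mul_left a)
    exact QuotientGroup.isOpenMap_coe _ ((h _ U.isOpen).preimage continuous_subtype_val)⟩

theorem isCompact_conj {U : OpenSubgroup G} (hU : IsCompact (U : Set G)) (a : G) :
    IsCompact (((U : Subgroup G).map (MulAut.conj a).toMonoidHom : Subgroup G) : Set G) :=
  hU.image (show Continuous fun x : G => a * x * a⁻¹ by fun_prop)

include hM in
theorem isCompact_conjImage {U : OpenSubgroup G} (hU : IsCompact (U : Set G)) (a : G) :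
    IsCompact (conjImage N U a : Set (ModCenter N)) :=
  (hM.isClosedEmbedding_subtypeVal.isCompact_preimage (isCompact_conj hU a)).image
    QuotientGroup.continuous_mk

theorem hasInvertibleIndices_conjImage (hb : HasOpenSubgroupBasis G) {U : OpenSubgroup G}
    (hU : IsCompact (U : Set G)) (hinv : HasInvertibleIndices R (U : Subgroup G)) (a : G) :
    HasInvertibleIndices R (conjImage N U a : Subgroup (ModCenter N)) :=
  ((hinv.conj a).subgroupOf (isCompact_conj hU a) hb _).quotient _

/-- This describes the domain of integration at a of a function supported on ZaU: it is a compact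
open subgroup of Z \ ZN when U is compact, so its volume is under control. -/
theorem mk_mem_conjImage_iff {U : OpenSubgroup G} {a : G} {h : ↥(Subgroup.center G ⊔ N)} :
    (h : ModCenter N) ∈ conjImage N U a ↔
      a⁻¹ * (h * a) ∈ Subgroup.center G ⊔ (U : Subgroup G) := by
  rw [inv_mul_mem_center_sup_iff]
  constructor
  · rintro ⟨y, ⟨u, hu, e⟩, ey⟩
    have h1 := QuotientGroup.eq.1 ey
    rw [Subgroup.mem_subgroupOf] at h1
    refine ⟨_, h1, u, hu, ?_⟩
    have e' : a * u * a⁻¹ = y := e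
    rw [mul_assoc, mul_inv_eq_iff_eq_mul.1 e', ← mul_assoc, ← Subgroup.mem_center_iff.1 h1 y]
    simp
  · rintro ⟨z, hz, u, hu, e⟩
    refine ⟨⟨z, Subgroup.mem_sup_left hz⟩⁻¹ * h, ⟨u, hu, ?_⟩, ?_⟩
    · change a * u * a⁻¹ = z⁻¹ * h
      rw [eq_inv_mul_iff_mul_eq, ← mul_assoc, ← mul_assoc, ← e, mul_inv_cancel_right]
    · change ((_ : ↥(Subgroup.center G ⊔ N)) : ModCenter N) = _
      rw [eq_comm, QuotientGroup.eq, Subgroup.mem_subgroupOf]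
      have := Subgroup.mem_center_iff.1 (Subgroup.inv_mem _ hz) h
      simp only [Subgroup.coe_mul, InvMemClass.coe_inv]
      rw [← this, inv_mul_cancel_left]
      exact Subgroup.inv_mem _ hz

/-- The factor χ(h)⁻¹ cancels, so the integrand is c times an indicator function. Both surjectivity
and the kernel of q rest on this computation. -/
theorem integrationMap_apply_of_mem_coset {μ : locConstCc R (ModCenter N) →ₗ[R] R}
    (hμ : IsHaar μ) {U : OpenSubgroup G} (hU : IsCompact (U : Set G))
    (f : cInd (Subgroup.center G) ω) (a : G) (c : R)
    (hin : ∀ h : ↥(Subgroup.center G ⊔ N), a⁻¹ * (h * a) ∈ Subgroup.center G ⊔ (U : Subgroup G) →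
      (f : G → R) (h * a) = χ h * c)
    (hout : ∀ h : ↥(Subgroup.center G ⊔ N),
      a⁻¹ * (h * a) ∉ Subgroup.center G ⊔ (U : Subgroup G) → (f : G → R) (h * a) = 0) :
    (integrationMap hχ hM hs hμ f : G → R) a =
      c * μ (subgroupIndicator R (conjImage N U a) (isCompact_conjImage hM hU a)) := by
  rw [integrationMap_apply, ← smul_eq_mul, ← map_smul]
  refine congrArg μ (locConstCc_ext fun h => ?_)
  change _ = c * (subgroupIndicator R (conjImage N U a) (isCompact_conjImage hM hU a) :
    ModCenter N → R) _
  rw [integrand_mk, subgroupIndicator_apply]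
  by_cases hh : a⁻¹ * (h * a) ∈ Subgroup.center G ⊔ (U : Subgroup G)
  · rw [if_pos (mk_mem_conjImage_iff.2 hh), hin h hh, Units.inv_mul_cancel_left, mul_one]
  · rw [if_neg (mt mk_mem_conjImage_iff.1 hh), hout h hh, mul_zero, mul_zero]

end Integration

/-! ### Relations in the coinvariants of ind_Z^G(ω) -/

section Coinvariants

variable {R : Type*} [Field R] {G : Type*} [Group G] [TopologicalSpace G] [IsTopologicalGroup G]
  {ω : Subgroup.center G →* Rˣ} {N : Subgroup G} {θ : N →* Rˣ}
  {χ : ↥(Subgroup.center G ⊔ N) →* Rˣ}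

/-- The action of `N` by left translation on `ind_Z^G(ω)`. -/
abbrev leftRep (ω : Subgroup.center G →* Rˣ) (N : Subgroup G) :
    Representation R N (cInd (Subgroup.center G) ω) :=
  (indCenterRep ω N).comp (MonoidHom.inl N G)

theorem leftRep_apply (n : N) (f : cInd (Subgroup.center G) ω) (x : G) :
    (leftRep ω N n f : G → R) x = (f : G → R) ((n : G)⁻¹ * x) :=
  congrArg (f : G → R) (mul_one _)

/-- The character `χ` of `Z N` extends the character `θ` of `N`. -/
def ExtendsRight (θ : N →* Rˣ) (χ : ↥(Subgroup.center G ⊔ N) →* Rˣ) : Prop :=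
  ∀ n : N, χ ⟨n, Subgroup.mem_sup_right n.2⟩ = θ n

/-- Writing h = zn, the center already acts through ω, so the relations for N and θ⁻¹ extend to
relations for ZN and χ. -/
theorem translate_sub_smul_mem_coinvKer (hχ : ExtendsCentral ω χ) (hθ : ExtendsRight θ χ)
    (f f' : cInd (Subgroup.center G) ω) (h : ↥(Subgroup.center G ⊔ N))
    (hf : ∀ x, (f' : G → R) x = (f : G → R) (h * x)) :
    f' - (χ h : R) • f ∈ coinvKer (leftRep ω N) θ⁻¹ := by
  obtain ⟨z, n, e⟩ := exists_center_mul h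
  have h1 : leftRep ω N n⁻¹ f - (((θ⁻¹ : N →* Rˣ) n⁻¹ : Rˣ) : R) • f ∈
      coinvKer (leftRep ω N) θ⁻¹ := Submodule.subset_span ⟨n⁻¹, f, rfl⟩
  have h2 : h = ⟨z, Subgroup.mem_sup_left z.2⟩ * ⟨n, Subgroup.mem_sup_right n.2⟩ :=
    Subtype.ext e.symm
  convert Submodule.smul_mem _ (ω z : R) h1 using 1
  rw [smul_sub, smul_smul, h2, map_mul, hχ z, hθ n, MonoidHom.inv_apply, map_inv θ, inv_inv,
    Units.val_mul]
  congr 1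
  ext x
  change _ = (ω z : R) * _
  rw [leftRep_apply, hf, ← e, InvMemClass.coe_inv, inv_inv, mul_assoc]
  exact f.2.2.1 z _

theorem exists_left_invariant_of_mem_cInd (hb : HasOpenSubgroupBasis G)
    (f : cInd (Subgroup.center G) ω) :
    ∃ U : OpenSubgroup G, ∀ u ∈ U, ∀ x, (f : G → R) (u * x) = (f : G → R) x := by
  obtain ⟨⟨W, hW⟩, hω, C, hC, hfC⟩ := f.2
  obtain ⟨U, hU⟩ := exists_openSubgroup_mul_left hb (isLocallyConstant_of_mul_right W hW) hC
  -- Invariance on C spreads to ZC because left translation by u commutes with z.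
  have key : ∀ u ∈ U, ∀ x, (f : G → R) x ≠ 0 → (f : G → R) (u * x) = (f : G → R) x := by
    intro u hu x hx
    obtain ⟨z, hz, c, hc, rfl⟩ := hfC x hx
    rw [← mul_assoc, Subgroup.mem_center_iff.1 hz u, mul_assoc]
    exact (hω ⟨z, hz⟩ _).trans ((congrArg _ (hU u hu c hc)).trans (hω ⟨z, hz⟩ _).symm)
  refine ⟨U, fun u hu x => ?_⟩
  by_cases hx : (f : G → R) x = 0
  · by_contra hne
    have h1 := key u⁻¹ (U.inv_mem hu) (u * x) fun h => hne (h.trans hx.symm)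
    rw [inv_mul_cancel_left] at h1
    exact hne h1.symm
  · exact key u hu x hx

/-- f is left invariant under some open U, and U ∩ ZN contains an h with χ(h) ≠ 1. The relation for
h reads (1 - χ(h)) f ≡ 0. -/
theorem coinvKer_eq_top_of_not_isSmoothChar (hb : HasOpenSubgroupBasis G)
    (hχ : ExtendsCentral ω χ) (hθ : ExtendsRight θ χ) (hs : ¬ IsSmoothChar χ) :
    coinvKer (leftRep ω N) θ⁻¹ = ⊤ := by
  refine eq_top_iff.2 fun f _ => ?_
  obtain ⟨U, hU⟩ := exists_left_invariant_of_mem_cInd hb f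
  obtain ⟨h, hhU, hh⟩ : ∃ h : ↥(Subgroup.center G ⊔ N), (h : G) ∈ U ∧ χ h ≠ 1 := by
    by_contra! hall
    exact hs (Subgroup.isOpen_mono (H₁ := (U : Subgroup G).subgroupOf _) (fun h hh => hall h hh)
      (U.isOpen.preimage continuous_subtype_val))
  have h1 := translate_sub_smul_mem_coinvKer hχ hθ f f h fun x => (hU h hhU x).symm
  have h2 : f - (χ h : R) • f = (1 - (χ h : R)) • f := by
    rw [sub_smul (M := cInd (Subgroup.center G) ω), one_smul]
  rw [h2] at h1
  refine (Submodule.smul_mem_iff _ ?_).1 h1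
  rw [sub_ne_zero, ne_comm]
  exact fun h => hh (Units.ext h)

/-- If F(g) ≠ 0, right invariance under U forces χ = 1 on gUg⁻¹ ∩ ZN. -/
theorem cInd_eq_zero_of_not_isSmoothChar (hs : ¬ IsSmoothChar χ)
    (F : cInd (Subgroup.center G ⊔ N) χ) : F = 0 := by
  by_contra hF
  obtain ⟨g, hg⟩ : ∃ g, (F : G → R) g ≠ 0 := by
    by_contra! h
    exact hF (Subtype.ext (funext h))
  obtain ⟨⟨U, hU⟩, hχ, -⟩ := F.2
  refine hs (Subgroup.isOpen_mono (H₁ := (((U.comap (MulAut.conj g⁻¹).toMonoidHom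
    (continuous_conj_inv g)).comap (Subgroup.subtype _) continuous_subtype_val :
    OpenSubgroup ↥(Subgroup.center G ⊔ N)) : Subgroup _)) (fun h hh => ?_)
    (OpenSubgroup.isOpen _))
  have h1 : g⁻¹ * h * (g⁻¹)⁻¹ ∈ U := hh
  have h2 := hU g _ h1
  rw [show g * (g⁻¹ * h * (g⁻¹)⁻¹) = h * g by group] at h2
  have h3 := hχ h g
  rw [h2] at h3
  exact Units.ext (mul_right_cancel₀ hg (h3.symm.trans (one_mul _).symm))

open Classical in
theorem restrictCoset_mul_right {U : OpenSubgroup G} {hU : IsCompact (U : Set G)} {F : G → R}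
    {hF : ∀ g, ∀ u ∈ U, F (g * u) = F g}
    {hFω : ∀ (z : Subgroup.center G) (g : G), F (z * g) = ω z * F g} {a : G} (x : G) {u : G}
    (hu : u ∈ U) : (restrictCoset U hU F hF hFω a : G → R) (x * u) =
      (restrictCoset U hU F hF hFω a : G → R) x := by
  have : a⁻¹ * (x * u) ∈ Subgroup.center G ⊔ (U : Subgroup G) ↔
      a⁻¹ * x ∈ Subgroup.center G ⊔ (U : Subgroup G) := by
    rw [← mul_assoc]
    exact Subgroup.mul_mem_cancel_right _ (Subgroup.mem_sup_right hu)
  exact if_congr this (hF x u hu) rfl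

theorem restrictCoset_eq_zero {U : OpenSubgroup G} {hU : IsCompact (U : Set G)} {F : G → R}
    {hF : ∀ g, ∀ u ∈ U, F (g * u) = F g}
    {hFω : ∀ (z : Subgroup.center G) (g : G), F (z * g) = ω z * F g} {a x : G} (hx : F x = 0) :
    (restrictCoset U hU F hF hFω a : G → R) x = 0 := by
  by_cases h : a⁻¹ * x ∈ Subgroup.center G ⊔ (U : Subgroup G)
  · rw [restrictCoset_of_mem h, hx]
  · exact restrictCoset_of_notMem h

/-- Translation by h carries the piece on ZhgU to a multiple of the piece on ZgU, with ratio
F(hg)/F(g); the coinvariant relation contributes χ(h)⁻¹. -/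
theorem restrictCoset_sub_smul_mem_coinvKer (hχ : ExtendsCentral ω χ) (hθ : ExtendsRight θ χ)
    {U : OpenSubgroup G} (hU : IsCompact (U : Set G)) {F : G → R}
    (hF : ∀ g, ∀ u ∈ U, F (g * u) = F g)
    (hFω : ∀ (z : Subgroup.center G) (g : G), F (z * g) = ω z * F g)
    (h : ↥(Subgroup.center G ⊔ N)) {g : G} (hg : F g ≠ 0) :
    restrictCoset U hU F hF hFω (h * g) -
      (((χ h)⁻¹ : Rˣ) * (F (h * g) * (F g)⁻¹) : R) • restrictCoset U hU F hF hFω g ∈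
        coinvKer (leftRep ω N) θ⁻¹ := by
  have h1 := translate_sub_smul_mem_coinvKer hχ hθ (restrictCoset U hU F hF hFω (h * g))
    ((F (h * g) * (F g)⁻¹) • restrictCoset U hU F hF hFω g) h fun x => by
      change _ * (restrictCoset U hU F hF hFω g : G → R) x = _
      have hiff : ((h : G) * g)⁻¹ * (h * x) = g⁻¹ * x := by group
      by_cases hx : g⁻¹ * x ∈ Subgroup.center G ⊔ (U : Subgroup G)
      · rw [restrictCoset_of_mem hx, restrictCoset_of_mem (by rwa [hiff])]
        obtain ⟨z, hz, u, hu, rfl⟩ := inv_mul_mem_center_sup_iff.1 hx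
        rw [hF _ u hu, ← mul_assoc, hF _ u hu, ← mul_assoc, Subgroup.mem_center_iff.1 hz h,
          mul_assoc z, hFω ⟨z, hz⟩, hFω ⟨z, hz⟩]
        field_simp
      · rw [restrictCoset_of_notMem hx, restrictCoset_of_notMem (by rwa [hiff]), mul_zero]
  have h2 := Submodule.smul_mem _ (-((χ h)⁻¹ : Rˣ) : R) h1
  convert h2 using 1
  rw [smul_sub, smul_smul, smul_smul, neg_mul, neg_mul, Units.inv_mul, neg_smul, neg_smul,
    one_smul]
  abel

end Coinvariants

/-! ### Kernel and image of the integration map -/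

section Kernel

variable {R : Type*} [Field R] {G : Type*} [Group G] [TopologicalSpace G] [IsTopologicalGroup G]
  {ω : Subgroup.center G →* Rˣ} {N : Subgroup G} {θ : N →* Rˣ}
  {χ : ↥(Subgroup.center G ⊔ N) →* Rˣ}
  (hχ : ExtendsCentral ω χ) (hθ : ExtendsRight θ χ)
  (hM : IsClosed ((Subgroup.center G ⊔ N : Subgroup G) : Set G)) (hs : IsSmoothChar χ)
  (hb : HasOpenSubgroupBasis G) {μ : locConstCc R (ModCenter N) →ₗ[R] R} (hμ : IsHaar μ)

theorem finite_image_support {U : OpenSubgroup G} (f : cInd (Subgroup.center G) ω) :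
    ((fun x : G => (x : G ⧸ (Subgroup.center G ⊔ (U : Subgroup G)))) ''
      Function.support (f : G → R)).Finite := by
  have : DiscreteTopology (G ⧸ (Subgroup.center G ⊔ (U : Subgroup G))) :=
    QuotientGroup.discreteTopology
      (Subgroup.isOpen_mono (le_sup_right : (U : Subgroup G) ≤ _) U.isOpen)
  obtain ⟨C, hC, hfC⟩ := f.2.2.2
  refine (hC.image QuotientGroup.continuous_mk).finite_of_discrete.subset ?_
  rintro _ ⟨x, hx, rfl⟩
  obtain ⟨z, hz, c, hc, rfl⟩ := hfC x hx
  refine ⟨c, hc, QuotientGroup.eq.2 ?_⟩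
  rw [← Subgroup.mem_center_iff.1 hz c, inv_mul_cancel_left]
  exact Subgroup.mem_sup_left hz

include hθ hb in
-- Induction on the number of cosets ZaU in the support: a defect of χ-equivariance lets one coset
-- be removed by a relation, and without any defect the integral detects f.
theorem mem_coinvKer_of_integrationMap_eq_zero
    (hle : coinvKer (leftRep ω N) θ⁻¹ ≤ LinearMap.ker (integrationMap hχ hM hs hμ))
    {U : OpenSubgroup G} (hU : IsCompact (U : Set G))
    (hinv : HasInvertibleIndices R (U : Subgroup G)) (n : ℕ) :
    ∀ f : cInd (Subgroup.center G) ω, (∀ g, ∀ u ∈ U, (f : G → R) (g * u) = (f : G → R) g) →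
      ((fun x : G => (x : G ⧸ (Subgroup.center G ⊔ (U : Subgroup G)))) ''
        Function.support (f : G → R)).ncard ≤ n →
      integrationMap hχ hM hs hμ f = 0 → f ∈ coinvKer (leftRep ω N) θ⁻¹ := by
  induction n with
  | zero =>
    intro f _ hn _
    have h1 := (Set.ncard_eq_zero (finite_image_support f)).1 (Nat.le_zero.1 hn)
    rw [Set.image_eq_empty, Function.support_eq_empty_iff] at h1
    have : f = 0 := Subtype.ext h1
    rw [this]
    exact Submodule.zero_mem _
  | succ n ih =>
    intro f hf hn hq
    -- Subtracting f₁ removes the coset of a from the support and adds none.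
    have step : ∀ (a : G) (f₁ : cInd (Subgroup.center G) ω), (f : G → R) a ≠ 0 →
        f₁ ∈ coinvKer (leftRep ω N) θ⁻¹ →
        (∀ g, ∀ u ∈ U, (f₁ : G → R) (g * u) = (f₁ : G → R) g) →
        (∀ x, a⁻¹ * x ∈ Subgroup.center G ⊔ (U : Subgroup G) → (f₁ : G → R) x = (f : G → R) x) →
        (∀ x, (f : G → R) x = 0 → (f₁ : G → R) x = 0) →
        f ∈ coinvKer (leftRep ω N) θ⁻¹ := by
      intro a f₁ ha hA hf₁ hin hzero
      rw [← sub_add_cancel f f₁]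
      refine Submodule.add_mem _ (ih (f - f₁) (fun g u hu => ?_) ?_ ?_) hA
      · exact congrArg₂ (· - ·) (hf g u hu) (hf₁ g u hu)
      · refine Nat.le_of_lt_succ (lt_of_lt_of_le ?_ hn)
        refine Set.ncard_lt_ncard ⟨Set.image_mono fun x hx hx0 => hx ?_, fun hsub => ?_⟩
          (finite_image_support f)
        · exact congrArg₂ (· - ·) hx0 (hzero x hx0) |>.trans (sub_zero _)
        · obtain ⟨x, hx, e⟩ := hsub ⟨a, ha, rfl⟩
          exact hx (sub_eq_zero.2 (hin x (QuotientGroup.eq.1 e.symm)).symm)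
      · rw [map_sub, hq, LinearMap.mem_ker.1 (hle hA), sub_zero]
    by_cases hex : ∃ (g : G) (h : ↥(Subgroup.center G ⊔ N)), (f : G → R) g ≠ 0 ∧
        (f : G → R) (h * g) ≠ 0 ∧ (g⁻¹ * (h * g) ∈ Subgroup.center G ⊔ (U : Subgroup G) →
          (f : G → R) (h * g) ≠ χ h * (f : G → R) g)
    · obtain ⟨g, h, hg, hhg, hne⟩ := hex
      have hA := restrictCoset_sub_smul_mem_coinvKer hχ hθ hU hf f.2.2.1 h hg
      set c : R := ((χ h)⁻¹ : Rˣ) * ((f : G → R) (h * g) * ((f : G → R) g)⁻¹) with hc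
      by_cases hmem : g⁻¹ * (h * g) ∈ Subgroup.center G ⊔ (U : Subgroup G)
      -- When hg and g share a coset, the two pieces are the same function, and failure of
      -- equivariance means c ≠ 1, so the piece itself is a relation.
      · have hiff : ∀ x, ((h : G) * g)⁻¹ * x ∈ Subgroup.center G ⊔ (U : Subgroup G) ↔
            g⁻¹ * x ∈ Subgroup.center G ⊔ (U : Subgroup G) := fun x => by
          rw [← Subgroup.mul_mem_cancel_left _ hmem]
          group
        have heq : restrictCoset (ω := ω) U hU f hf f.2.2.1 (h * g) =
            restrictCoset U hU f hf f.2.2.1 g :=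
          Subtype.ext (funext fun x => by
            by_cases hx : g⁻¹ * x ∈ Subgroup.center G ⊔ (U : Subgroup G)
            · rw [restrictCoset_of_mem hx, restrictCoset_of_mem ((hiff x).2 hx)]
            · rw [restrictCoset_of_notMem hx, restrictCoset_of_notMem (mt (hiff x).1 hx)])
        have hc1 : 1 - c ≠ 0 := by
          refine sub_ne_zero.2 fun h1 => hne hmem ?_
          rw [hc, Units.eq_inv_mul_iff_mul_eq, mul_one, eq_mul_inv_iff_mul_eq₀ hg] at h1
          exact h1.symm
        have hA' : (1 - c) • restrictCoset U hU f hf f.2.2.1 g ∈ coinvKer (leftRep ω N) θ⁻¹ := by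
          rw [heq] at hA
          rwa [sub_smul (M := cInd (Subgroup.center G) ω), one_smul]
        exact step g _ hg ((Submodule.smul_mem_iff _ hc1).1 hA')
          (fun x u hu => restrictCoset_mul_right x hu) (fun x hx => restrictCoset_of_mem hx)
          (fun x hx => restrictCoset_eq_zero hx)
      -- For distinct cosets, the difference of the pieces agrees with f on ZhgU, since the piece on
      -- ZgU vanishes there.
      · refine step (h * g) _ hhg hA (fun x u hu => ?_) (fun x hx => ?_) (fun x hx => ?_)
        · exact congrArg₂ (· - c * ·) (restrictCoset_mul_right x hu) (restrictCoset_mul_right x hu)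
        · refine (congrArg₂ (· - c * ·) (restrictCoset_of_mem hx)
            (restrictCoset_of_notMem fun hx' => hmem ?_)).trans ?_
          · have := Subgroup.mul_mem _ hx' (Subgroup.inv_mem _ hx)
            convert this using 1
            group
          · rw [mul_zero, sub_zero]
        · refine (congrArg₂ (· - c * ·) (restrictCoset_eq_zero hx)
            (restrictCoset_eq_zero hx)).trans ?_
          rw [mul_zero, sub_zero]
    -- Now f is χ-equivariant along ZN inside ZgU and vanishes on the rest of ZNg, so q(f)(g) is
    -- f(g) times a nonzero volume.
    · push Not at hex
      have : f = 0 := by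
        by_contra hf0
        obtain ⟨g, hg⟩ : ∃ g, (f : G → R) g ≠ 0 := by
          by_contra! h
          exact hf0 (Subtype.ext (funext h))
        have h1 := integrationMap_apply_of_mem_coset hχ hM hs hμ hU f g ((f : G → R) g)
          (fun h hh => ?_) (fun h hh => ?_)
        · rw [hq] at h1
          exact mul_ne_zero hg (hμ.apply_subgroupIndicator_ne_zero
            ((hb.subgroup _).quotient _) _ (isCompact_conjImage hM hU g)
            (hasInvertibleIndices_conjImage hb hU hinv g)) h1.symm
        · refine (hex g h hg ?_).2
          obtain ⟨z, hz, u, hu, e⟩ := inv_mul_mem_center_sup_iff.1 hh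
          rw [e, hf _ u hu]
          exact (f.2.2.1 ⟨z, hz⟩ g).trans_ne (mul_ne_zero (Units.ne_zero _) hg)
        · by_contra h0
          exact hh (hex g h hg h0).1
      rw [this]
      exact Submodule.zero_mem _

/-- Induction on representatives of the double cosets ZNaU: the restriction of F to ZaU integrates
to a nonzero multiple of F on ZNaU and to zero elsewhere. -/
theorem mem_range_integrationMap {U : OpenSubgroup G} (hU : IsCompact (U : Set G))
    (hb : HasOpenSubgroupBasis G)
    (hinv : HasInvertibleIndices R (U : Subgroup G)) (s : Finset G) :
    ∀ F : cInd (Subgroup.center G ⊔ N) χ,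
      (∀ g, ∀ u ∈ U, (F : G → R) (g * u) = (F : G → R) g) →
      (∀ x, (F : G → R) x ≠ 0 → ∃ a ∈ s, ∃ h ∈ Subgroup.center G ⊔ N, ∃ u ∈ U, x = h * a * u) →
      F ∈ LinearMap.range (integrationMap hχ hM hs hμ) := by
  classical
  induction s using Finset.induction_on with
  | empty =>
    intro F _ hF
    have : F = 0 := Subtype.ext (funext fun x => by
      by_contra h
      obtain ⟨a, ha, -⟩ := hF x h
      simp at ha)
    rw [this]
    exact Submodule.zero_mem _
  | insert a s _ ih =>
    intro F hF hsupp
    have hFω : ∀ (z : Subgroup.center G) (g : G),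
        (F : G → R) (z * g) = ω z * (F : G → R) g := fun z g => by
      rw [← hχ z]
      exact F.2.2.1 ⟨z, Subgroup.mem_sup_left z.2⟩ g
    let f : cInd (Subgroup.center G) ω := restrictCoset U hU F hF hFω a
    let c := μ (subgroupIndicator R (conjImage N U a) (isCompact_conjImage hM hU a))
    have hc : c ≠ 0 := hμ.apply_subgroupIndicator_ne_zero ((hb.subgroup _).quotient _) _
      (isCompact_conjImage hM hU a) (hasInvertibleIndices_conjImage hb hU hinv a)
    have hfa : (integrationMap hχ hM hs hμ f : G → R) a = (F : G → R) a * c :=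
      integrationMap_apply_of_mem_coset hχ hM hs hμ hU f a _
        (fun h hh => (restrictCoset_of_mem hh).trans (F.2.2.1 h a))
        (fun h hh => restrictCoset_of_notMem hh)
    have hfU : ∀ g, ∀ u ∈ U, (integrationMap hχ hM hs hμ f : G → R) (g * u) =
        (integrationMap hχ hM hs hμ f : G → R) g := fun g u hu => by
      refine congrArg μ (locConstCc_ext fun h => ?_)
      rw [integrand_mk, integrand_mk, ← mul_assoc, restrictCoset_mul_right _ hu]
    have hF' : F - c⁻¹ • integrationMap hχ hM hs hμ f ∈
        LinearMap.range (integrationMap hχ hM hs hμ) := by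
      refine ih _ (fun g u hu => ?_) (fun x hx => ?_)
      · exact congrArg₂ (· - c⁻¹ * ·) (hF g u hu) (hfU g u hu)
      · by_cases hxa : ∃ h ∈ Subgroup.center G ⊔ N, ∃ u ∈ U, x = h * a * u
        · obtain ⟨h, hh, u, hu, rfl⟩ := hxa
          refine absurd ?_ hx
          have e1 : (F : G → R) (h * a * u) = χ ⟨h, hh⟩ * (F : G → R) a :=
            (hF _ u hu).trans (F.2.2.1 ⟨h, hh⟩ a)
          have e2 : (integrationMap hχ hM hs hμ f : G → R) (h * a * u) =
              χ ⟨h, hh⟩ * ((F : G → R) a * c) :=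
            (hfU _ u hu).trans (((integrationMap hχ hM hs hμ f).2.2.1 ⟨h, hh⟩ a).trans
              (congrArg _ hfa))
          refine (congrArg₂ (· - c⁻¹ * ·) e1 e2).trans ?_
          field_simp
          ring
        · have h0 : (integrationMap hχ hM hs hμ f : G → R) x = 0 := by
            have : integrand hχ hM hs f x = 0 := locConstCc_ext fun h => by
              rw [integrand_mk, show (f : G → R) (h * x) = 0 from
                restrictCoset_of_notMem fun hmem => hxa ?_, mul_zero]
              · rfl
              · obtain ⟨z, hz, u, hu, e⟩ := inv_mul_mem_center_sup_iff.1 hmem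
                refine ⟨(h : G)⁻¹ * z, Subgroup.mul_mem _ (Subgroup.inv_mem _ h.2)
                  (Subgroup.mem_sup_left hz), u, hu, ?_⟩
                rw [mul_assoc, mul_assoc, ← mul_assoc z, ← e, inv_mul_cancel_left]
            rw [integrationMap_apply, this, map_zero]
          have hFx : (F : G → R) x ≠ 0 := fun hFx => hx <|
            (congrArg₂ (· - c⁻¹ * ·) hFx h0).trans (by rw [mul_zero, sub_zero])
          obtain ⟨b, hb, hbx⟩ := hsupp x hFx
          rcases Finset.mem_insert.1 hb with rfl | hb
          · exact absurd hbx hxa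
          · exact ⟨b, hb, hbx⟩
    have := Submodule.add_mem _ hF' (Submodule.smul_mem _ c⁻¹ ⟨f, rfl⟩)
    rwa [sub_add_cancel] at this

/-- For every Haar measure there is a surjective morphism `ind_Z^G(ω) → ind_{ZN}^G(χ)` with
kernel the span of the `n f - θ(n)⁻¹ f`, given by integration when `χ` is smooth. -/
theorem exists_integration_intertwiningMap {K : OpenSubgroup G} (hK : IsCompact (K : Set G))
    (hinv : HasInvertibleIndices R (K : Subgroup G)) (hb : HasOpenSubgroupBasis G)
    (hχ : ExtendsCentral ω χ) (hθ : ExtendsRight θ χ)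
    (hM : IsClosed ((Subgroup.center G ⊔ N : Subgroup G) : Set G)) (hNex : IsExhausted R N)
    {μ : locConstCc R (ModCenter N) →ₗ[R] R} (hμ : IsHaar μ) :
    ∃ q : (indCenterRep ω N).IntertwiningMap (indProdRep χ),
      (IsSmoothChar χ → ∀ (f : cInd (Subgroup.center G) ω) (g : G),
        ∃ φ : locConstCc R (ModCenter N), (∀ h : ↥(Subgroup.center G ⊔ N),
          (φ : ModCenter N → R) h = ((χ h)⁻¹ : Rˣ) * (f : G → R) (h * g)) ∧
          (q f : G → R) g = μ φ) ∧
      Function.Surjective q ∧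
      LinearMap.ker q.toLinearMap = coinvKer (leftRep ω N) θ⁻¹ := by
  by_cases hs : IsSmoothChar χ
  · have hK₀ : IsCompact (conjImage N K 1 : Set (ModCenter N)) := isCompact_conjImage hM hK 1
    let q : (indCenterRep ω N).IntertwiningMap (indProdRep χ) :=
      ⟨integrationMap hχ hM hs hμ, fun p => LinearMap.ext fun f => Subtype.ext <| funext fun x =>
        integrationMap_apply_left_mul hχ hM hs ((hb.subgroup _).quotient _) _ hK₀ hNex hμ p.1 f
          (indCenterRep ω N p f) p.2 (fun _ => rfl) x⟩
    have hle : coinvKer (leftRep ω N) θ⁻¹ ≤ LinearMap.ker (integrationMap hχ hM hs hμ) := by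
      refine Submodule.span_le.2 ?_
      rintro _ ⟨n, f, rfl⟩
      rw [SetLike.mem_coe, LinearMap.mem_ker, map_sub, map_smul, sub_eq_zero]
      have h1 : integrationMap hχ hM hs hμ (leftRep ω N n f) =
          indProdRep χ (n, 1) (integrationMap hχ hM hs hμ f) :=
        congrArg (fun T => T f) (q.isIntertwining' (n, 1))
      rw [h1]
      ext x
      change (integrationMap hχ hM hs hμ f : G → R) ((n : G)⁻¹ * x * 1) = _ * _
      rw [mul_one]
      have h2 := (integrationMap hχ hM hs hμ f).2.2.1 ⟨n, Subgroup.mem_sup_right n.2⟩⁻¹ x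
      rw [map_inv, hθ n] at h2
      exact h2
    refine ⟨q, fun _ f g => ⟨integrand hχ hM hs f g, fun h => rfl, rfl⟩, fun F => ?_,
      le_antisymm (fun f hf => ?_) hle⟩
    · obtain ⟨⟨U, hU⟩, -, C, hC, hFC⟩ := F.2
      obtain ⟨W, hWU, hW, hWinv⟩ := exists_compact_hasInvertibleIndices K.isOpen hK hinv U
      obtain ⟨s, -, hs'⟩ := hC.elim_nhds_subcover (fun a => (a * ·) '' (W : Set G))
        fun a _ => ((isOpenMap_mul_left a) _ W.isOpen).mem_nhds ⟨1, W.one_mem, mul_one a⟩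
      refine mem_range_integrationMap hχ hM hs hμ hW hb hWinv s F
        (fun g u hu => hU g u (hWU hu)) fun x hx => ?_
      obtain ⟨h, hh, c, hc, rfl⟩ := hFC x hx
      obtain ⟨a, ha, u, hu, rfl⟩ := Set.mem_iUnion₂.1 (hs' hc)
      exact ⟨a, ha, h, hh, u, hu, (mul_assoc _ _ _).symm⟩
    · obtain ⟨U, hU⟩ := f.2.1
      obtain ⟨W, hWU, hW, hWinv⟩ := exists_compact_hasInvertibleIndices K.isOpen hK hinv U
      exact mem_coinvKer_of_integrationMap_eq_zero hχ hθ hM hs hb hμ hle hW hWinv _ f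
        (fun g u hu => hU g u (hWU hu)) le_rfl hf
  -- For χ not smooth the target is zero and the relations span the whole source, so the zero map
  -- qualifies.
  · refine ⟨0, fun h => absurd h hs, fun F => ⟨0, ?_⟩, ?_⟩
    · rw [cInd_eq_zero_of_not_isSmoothChar hs F, map_zero]
    · rw [coinvKer_eq_top_of_not_isSmoothChar hb hχ hθ hs]
      exact LinearMap.ker_zero

end Kernel

/-! ### Schur's lemma and injectivity of the coefficient map -/

section Schur

variable {R : Type*} [Field R] {G : Type*} [Group G]
  {V : Type*} [AddCommGroup V] [Module R V] {π : Representation R G V}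

theorem eq_bot_or_eq_top_of_isIrreducible (hirr : π.IsIrreducible) (W : Submodule R V)
    (hW : ∀ g, ∀ w ∈ W, π g w ∈ W) : W = ⊥ ∨ W = ⊤ := by
  have h := hirr.eq_bot_or_eq_top ⟨W, fun g w hw => hW g w hw⟩
  exact h.imp (congrArg Subrepresentation.toSubmodule) (congrArg Subrepresentation.toSubmodule)

theorem span_orbit_eq_top (hirr : π.IsIrreducible) {v : V} (hv : v ≠ 0) :
    Submodule.span R (Set.range fun g => π g v) = ⊤ := by
  refine (eq_bot_or_eq_top_of_isIrreducible hirr _ fun g w hw => ?_).resolve_left fun h => hv ?_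
  · have h1 := Submodule.mem_map_of_mem (f := π g) hw
    rw [Submodule.map_span] at h1
    refine Submodule.span_mono ?_ h1
    rintro _ ⟨_, ⟨g', rfl⟩, rfl⟩
    exact ⟨g * g', by simp⟩
  · have h1 : v ∈ Submodule.span R (Set.range fun g => π g v) :=
      Submodule.subset_span ⟨1, by simp⟩
    rwa [h, Submodule.mem_bot] at h1

variable [TopologicalSpace G] [IsTopologicalGroup G]

/-- The orbit of one v spans the U-coinvariants, so a basis can be chosen inside it. A linear form
equal to 1 on this basis is smooth on V, so compactness of its coefficient puts the basis in the
span of the image of Cv, which is finite. -/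
theorem finiteDimensional_coinv_of_isZCompact (hsm : IsSmooth π) (hirr : π.IsIrreducible)
    (hZc : IsZCompact π) {ω : Subgroup.center G →* Rˣ} (hω : IsCentralCharacter π ω)
    (U : OpenSubgroup G) :
    FiniteDimensional R (Coinv (π.comp (U : Subgroup G).subtype) (1 : _ →* Rˣ)) := by
  set A := coinvKer (π.comp (U : Subgroup G).subtype) (1 : _ →* Rˣ) with hA
  rcases subsingleton_or_nontrivial V with hV | hV
  · infer_instance
  obtain ⟨v, hv⟩ := exists_ne (0 : V)
  obtain ⟨b, hbS, hbspan, hbli⟩ := exists_linearIndependent R (Set.range fun g => A.mkQ (π g v))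
  have hS : Submodule.span R (Set.range fun g => A.mkQ (π g v)) = ⊤ := by
    have : (Set.range fun g => A.mkQ (π g v)) = A.mkQ '' Set.range fun g => π g v := by
      rw [← Set.range_comp]; rfl
    rw [this, ← Submodule.map_span, span_orbit_eq_top hirr hv, Submodule.map_top,
      Submodule.range_mkQ]
  let B : Module.Basis b R (V ⧸ A) := Module.Basis.mk hbli (by
    rw [Subtype.range_coe, hbspan, hS])
  let ℓ : V ⧸ A →ₗ[R] R := B.constr R fun _ => 1
  have hℓ : ∀ x : b, ℓ x = 1 := fun x => by
    have := B.constr_basis R (fun _ => (1 : R)) x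
    rwa [Module.Basis.mk_apply] at this
  let ξ : ContragredientSpace π := ⟨ℓ ∘ₗ A.mkQ, U, fun u hu => LinearMap.ext fun w => by
    change ℓ (A.mkQ (π u⁻¹ w)) = ℓ (A.mkQ w)
    refine congrArg ℓ ((Submodule.Quotient.eq A).2 (Submodule.subset_span ?_))
    exact ⟨⟨u⁻¹, U.inv_mem hu⟩, w, by simp⟩⟩
  obtain ⟨C, hC, hξC⟩ := hZc ξ v
  have hfin : ((fun c => A.mkQ (π c v)) '' C).Finite := by
    let _ : TopologicalSpace (V ⧸ A) := ⊥
    have : DiscreteTopology (V ⧸ A) := ⟨rfl⟩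
    obtain ⟨W, hW⟩ := hsm v
    refine (hC.image (IsLocallyConstant.continuous (isLocallyConstant_of_mul_right W
      fun g u hu => ?_))).finite_of_discrete
    rw [map_mul, Module.End.mul_apply, hW u hu]
  refine ⟨⟨hfin.toFinset, ?_⟩⟩
  rw [← top_le_iff, ← hS, ← hbspan, Submodule.span_le, Set.Finite.coe_toFinset]
  intro x hx
  obtain ⟨g, rfl⟩ := hbS hx
  obtain ⟨z, hz, c, hc, rfl⟩ := hξC g (by
    change ℓ (A.mkQ (π g v)) ≠ 0
    rw [hℓ ⟨_, hx⟩]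
    exact one_ne_zero)
  have h1 := hω ⟨z, hz⟩ (π c v)
  dsimp only at h1 ⊢
  rw [map_mul, Module.End.mul_apply, h1, map_smul]
  exact Submodule.smul_mem _ _ (Submodule.subset_span ⟨c, hc, rfl⟩)

/-- Schur's lemma. -/
theorem exists_eq_smul_of_commute [IsAlgClosed R] (hsm : IsSmooth π) (hirr : π.IsIrreducible)
    (hZc : IsZCompact π) {ω : Subgroup.center G →* Rˣ} (hω : IsCentralCharacter π ω)
    {ξ : ContragredientSpace π} (hξ : ξ ≠ 0) (T : V →ₗ[R] V)
    (hT : ∀ g v, T (π g v) = π g (T v)) : ∃ a : R, ∀ v, T v = a • v := by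
  obtain ⟨U, hU⟩ := ξ.2
  have := finiteDimensional_coinv_of_isZCompact hsm hirr hZc hω U
  set A := coinvKer (π.comp (U : Subgroup G).subtype) (1 : _ →* Rˣ) with hA
  have hAξ : A ≤ LinearMap.ker (ξ : Module.Dual R V) := by
    refine Submodule.span_le.2 ?_
    rintro _ ⟨u, v, rfl⟩
    have h1 : (ξ : Module.Dual R V) (π ((u : G)⁻¹)⁻¹ v) = (ξ : Module.Dual R V) v :=
      LinearMap.congr_fun (hU (u : G)⁻¹ (U.inv_mem u.2)) v
    rw [inv_inv] at h1
    rw [SetLike.mem_coe, LinearMap.mem_ker, map_sub, map_smul, MonoidHom.one_apply, Units.val_one,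
      one_smul, sub_eq_zero]
    exact h1
  have : Nontrivial (V ⧸ A) := by
    refine Submodule.Quotient.nontrivial_iff.2 fun h => hξ (Subtype.ext ?_)
    rw [h, top_le_iff, LinearMap.ker_eq_top] at hAξ
    exact hAξ
  have hTA : A ≤ A.comap T := by
    refine Submodule.span_le.2 ?_
    rintro _ ⟨u, v, rfl⟩
    refine Submodule.subset_span ⟨u, T v, ?_⟩
    rw [map_sub, map_smul]
    exact congrArg (· - _) (hT u v)
  obtain ⟨a, ha⟩ := Module.End.exists_eigenvalue (A.mapQ A T hTA)
  obtain ⟨y, hy⟩ := ha.exists_hasEigenvector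
  refine ⟨a, fun v => ?_⟩
  -- The range is used rather than the kernel because surjectivity passes to the quotient V / A.
  -- There, finite dimension turns it into injectivity, which the eigenvector y contradicts.
  have hr : LinearMap.range (T - a • (LinearMap.id : V →ₗ[R] V)) = ⊥ := by
    refine (eq_bot_or_eq_top_of_isIrreducible hirr _ ?_).resolve_right fun htop => ?_
    · rintro g _ ⟨w, rfl⟩
      exact ⟨π g w, by simp [hT]⟩
    · have hsurj : Function.Surjective
          (A.mapQ A T hTA - a • (LinearMap.id : V ⧸ A →ₗ[R] V ⧸ A)) := by
        intro w
        obtain ⟨w, rfl⟩ := Submodule.Quotient.mk_surjective _ w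
        obtain ⟨v, rfl⟩ := LinearMap.range_eq_top.1 htop w
        exact ⟨Submodule.Quotient.mk v, rfl⟩
      have hinj := LinearMap.injective_iff_surjective.2 hsurj
      refine hy.2 (hinj ?_)
      rw [map_zero, LinearMap.sub_apply, hy.apply_eq_smul, LinearMap.smul_apply,
        LinearMap.id_apply, sub_self]
  have := LinearMap.congr_fun (LinearMap.range_eq_bot.1 hr) v
  exact sub_eq_zero.1 this

omit [TopologicalSpace G] [IsTopologicalGroup G] in
-- All endomorphisms of π are scalars, so every linear f commutes with them and Jacobson density
-- applies to it.
theorem exists_asAlgebraHom_eq (hirr : π.IsIrreducible)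
    (hschur : ∀ T : V →ₗ[R] V, (∀ g v, T (π g v) = π g (T v)) → ∃ a : R, ∀ v, T v = a • v)
    (f : V →ₗ[R] V) (s : Finset V) :
    ∃ r : MonoidAlgebra R G, ∀ v ∈ s, π.asAlgebraHom r v = f v := by
  have := (Representation.irreducible_iff_isSimpleModule_asModule π).1 hirr
  have hend : ∀ T : Module.End (MonoidAlgebra R G) π.asModule, ∃ a : R, ∀ v : π.asModule,
      T v = a • v := fun T => by
    obtain ⟨a, ha⟩ := hschur (π.asModuleEquiv.toLinearMap ∘ₗ (T.restrictScalars R) ∘ₗ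
      π.asModuleEquiv.symm.toLinearMap) fun g v => by
        simp only [LinearMap.comp_apply, LinearEquiv.coe_coe, LinearMap.restrictScalars_apply]
        rw [Representation.asModuleEquiv_symm_map_rho, map_smul,
          Representation.asModuleEquiv_map_smul]
        simp
    exact ⟨a, fun v => π.asModuleEquiv.injective (by simpa using ha (π.asModuleEquiv v))⟩
  let F : Module.End (Module.End (MonoidAlgebra R G) π.asModule) π.asModule :=
    { toFun := fun v => π.asModuleEquiv.symm (f (π.asModuleEquiv v))
      map_add' := fun v w => by simp
      map_smul' := fun T v => by
        obtain ⟨a, ha⟩ := hend T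
        simp [Module.End.smul_def, ha] }
  classical
  obtain ⟨r, hr⟩ := jacobson_density F (s.image π.asModuleEquiv.symm)
  refine ⟨r, fun v hv => ?_⟩
  have h1 := congrArg π.asModuleEquiv (hr _ (Finset.mem_image_of_mem _ hv))
  rw [Representation.asModuleEquiv_map_smul] at h1
  simpa [F] using h1.symm

theorem coeffMap_tmul_apply (hsm : IsSmooth π) (hZc : IsZCompact π)
    (ω : Subgroup.center G →* Rˣ) (hω : IsCentralCharacter π ω) (ξ : ContragredientSpace π)
    (v : V) (g : G) : (coeffMap π hsm hZc ω hω (ξ ⊗ₜ[R] v) : G → R) g =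
      (ξ : Module.Dual R V) (π g v) := rfl

theorem contragredient_apply (g : G) (ξ : ContragredientSpace π) (v : V) :
    (contragredient π g ξ : Module.Dual R V) v = (ξ : Module.Dual R V) (π g⁻¹ v) := rfl

section CoefficientLift

variable {W : Type*} [AddCommGroup W] [Module R W] {ι : W → ContragredientSpace π}
  (hadd : ∀ ξ η, ι (ξ + η) = ι ξ + ι η) (hsmul : ∀ (a : R) ξ, ι (a • ξ) = a • ι ξ)
  (hsm : IsSmooth π) (hZc : IsZCompact π) {ω : Subgroup.center G →* Rˣ}
  (hω : IsCentralCharacter π ω)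

/-- The coefficient map on `W ⊗ π`, for a linear map `ι` from `W` to the contragredient of `π`. -/
def coeffLift : W ⊗[R] V →ₗ[R] cInd (Subgroup.center G) ω :=
  TensorProduct.lift (LinearMap.mk₂ R (fun ξ v => coeffMap π hsm hZc ω hω (ι ξ ⊗ₜ[R] v))
    (fun ξ η v => by rw [hadd, TensorProduct.add_tmul, map_add])
    (fun a ξ v => by rw [hsmul, ← TensorProduct.smul_tmul', map_smul])
    (fun ξ v w => by rw [TensorProduct.tmul_add, map_add])
    (fun a ξ v => by rw [TensorProduct.tmul_smul, map_smul]))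

theorem coeffLift_tmul (ξ : W) (v : V) : coeffLift hadd hsmul hsm hZc hω (ξ ⊗ₜ[R] v) =
    coeffMap π hsm hZc ω hω (ι ξ ⊗ₜ[R] v) := rfl

/-- If ∑ ξᵢ(π(g)vᵢ) = 0 for all g with the vᵢ independent, the same holds over the group algebra. An
element sending vⱼ to w and the other vᵢ to 0 gives ξⱼ(w) = 0. -/
theorem coeffLift_injective [IsAlgClosed R] (hirr : π.IsIrreducible)
    (hι : ∀ ξ, ι ξ = 0 → ξ = 0) : Function.Injective (coeffLift hadd hsmul hsm hZc hω) := by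
  classical
  let b := Module.Basis.ofVectorSpace R V
  let e := TensorProduct.equivFinsuppOfBasisRight (M := W) b
  rw [injective_iff_map_eq_zero]
  intro x hx
  obtain ⟨y, rfl⟩ := e.symm.surjective x
  rw [LinearEquiv.map_eq_zero_iff]
  by_contra hy
  obtain ⟨j, hj⟩ : ∃ j, y j ≠ 0 := by
    by_contra! h
    exact hy (Finsupp.ext h)
  have hsum : ∀ g, ∑ i ∈ y.support, (ι (y i) : Module.Dual R V) (π g (b i)) = 0 := fun g => by
    have h1 : (coeffLift hadd hsmul hsm hZc hω (e.symm y) : G → R) g = 0 := by rw [hx]; rfl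
    rw [← h1, TensorProduct.equivFinsuppOfBasisRight_symm_apply, Finsupp.sum, map_sum,
      Submodule.coe_sum, Finset.sum_apply]
    rfl
  have hsum' : ∀ r : MonoidAlgebra R G,
      ∑ i ∈ y.support, (ι (y i) : Module.Dual R V) (π.asAlgebraHom r (b i)) = 0 := fun r => by
    induction r using MonoidAlgebra.induction_on with
    | of g => simpa using hsum g
    | add r r' h h' => simp [Finset.sum_add_distrib, h, h']
    | smul a r h => simp [← Finset.mul_sum, h]
  have hj0 : ι (y j) ≠ 0 := fun h => hj (hι _ h)
  obtain ⟨w, hw⟩ : ∃ w, (ι (y j) : Module.Dual R V) w ≠ 0 := by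
    by_contra! h
    exact hj0 (Subtype.ext (LinearMap.ext h))
  obtain ⟨r, hr⟩ := exists_asAlgebraHom_eq hirr
    (exists_eq_smul_of_commute hsm hirr hZc hω hj0) (b.constr R (Pi.single j w))
    (y.support.image b)
  have h1 := hsum' r
  rw [Finset.sum_eq_single j] at h1
  · rw [hr _ (Finset.mem_image_of_mem _ (Finsupp.mem_support_iff.2 hj)), b.constr_basis,
      Pi.single_eq_same] at h1
    exact hw h1
  · intro i hi hij
    rw [hr _ (Finset.mem_image_of_mem _ hi), b.constr_basis, Pi.single_eq_of_ne hij, map_zero]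
  · intro h
    exact absurd (Finsupp.mem_support_iff.2 hj) h

end CoefficientLift

end Schur

/-! ### Exactness of coinvariants by averaging -/

section Exactness

variable {R : Type*} [Field R] {N : Type*} [Group N]
  {W W' : Type*} [AddCommGroup W] [Module R W] [AddCommGroup W'] [Module R W']

/-- The operator `∑ χ(k)⁻¹ σ(k)`, for `k` in a set of representatives of `K / L`. -/
def twistedSum (σ : Representation R N W) (χ : N →* Rˣ) {K : Subgroup N} (L : Subgroup K)
    [Fintype (K ⧸ L)] : W →ₗ[R] W :=
  ∑ y : K ⧸ L, (((χ (y.out : N))⁻¹ : Rˣ) : R) • σ (y.out : N)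

theorem twistedSum_apply (σ : Representation R N W) (χ : N →* Rˣ) {K : Subgroup N}
    (L : Subgroup K) [Fintype (K ⧸ L)] (w : W) :
    twistedSum σ χ L w = ∑ y : K ⧸ L, (((χ (y.out : N))⁻¹ : Rˣ) : R) • σ (y.out : N) w := by
  simp [twistedSum]

/-- Right multiplication by n permutes K / L, because L is normal. -/
theorem twistedSum_sub_smul_eq_zero (σ : Representation R N W) (χ : N →* Rˣ) {K : Subgroup N}
    (L : Subgroup K) [L.Normal] [Fintype (K ⧸ L)] {w : W} (hw : ∀ l ∈ L, σ (l : N) w = w)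
    (hχ : ∀ l ∈ L, χ (l : N) = 1) (n : K) :
    twistedSum σ χ L (σ (n : N) w - (χ (n : N) : R) • w) = 0 := by
  let ψ : K → W := fun k => (((χ (k : N))⁻¹ : Rˣ) : R) • σ (k : N) w
  have hψ : ∀ k, ∀ l ∈ L, ψ (k * l) = ψ k := fun k l hl => by
    simp only [ψ, Subgroup.coe_mul, map_mul, hχ l hl, mul_one, Module.End.mul_apply, hw l hl]
  have hout : ∀ k k' : K, (k : K ⧸ L) = k' → ψ k = ψ k' := fun k k' h => by
    have := hψ k _ (QuotientGroup.eq.1 h)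
    rwa [mul_inv_cancel_left, eq_comm] at this
  have h1 : ∑ y : K ⧸ L, ψ (y.out * n) = ∑ y : K ⧸ L, ψ y.out := by
    refine Fintype.sum_equiv (Equiv.mulRight (n : K ⧸ L)) _ _ fun y => hout _ _ ?_
    rw [QuotientGroup.mk_mul, QuotientGroup.out_eq', QuotientGroup.out_eq']
    rfl
  have h2 : ∀ y : K ⧸ L, (((χ (y.out : N))⁻¹ : Rˣ) : R) • σ (y.out : N) (σ (n : N) w) =
      (χ (n : N) : R) • ψ (y.out * n) := fun y => by
    simp only [ψ, Subgroup.coe_mul, map_mul, Module.End.mul_apply, smul_smul, mul_inv_rev,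
      Units.val_mul, Units.mul_inv_cancel_left]
  rw [map_sub, map_smul, twistedSum_apply, twistedSum_apply, Finset.sum_congr rfl fun y _ => h2 y,
    ← Finset.smul_sum, h1, sub_self]

/-- Each summand is congruent to w. The choice of representatives is irrelevant here, so w need not
be fixed by L. -/
theorem card_smul_sub_twistedSum_mem_coinvKer (σ : Representation R N W) (χ : N →* Rˣ)
    {K : Subgroup N} (L : Subgroup K) [Fintype (K ⧸ L)] (w : W) :
    (Fintype.card (K ⧸ L) : R) • w - twistedSum σ χ L w ∈ coinvKer σ χ := by
  rw [twistedSum_apply, Nat.cast_smul_eq_nsmul, ← Finset.card_univ, ← Finset.sum_const,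
    ← Finset.sum_sub_distrib]
  refine Submodule.sum_mem _ fun y _ => ?_
  have h1 : σ (y.out : N) w - (χ (y.out : N) : R) • w ∈ coinvKer σ χ :=
    Submodule.subset_span ⟨_, _, rfl⟩
  have h2 := Submodule.smul_mem _ (-(((χ (y.out : N))⁻¹ : Rˣ) : R)) h1
  convert h2 using 1
  rw [smul_sub, smul_smul, neg_mul, Units.inv_mul, neg_smul, neg_smul, one_smul]
  abel

variable [TopologicalSpace N]

/-- Only finitely many relations enter w: C collects their group elements, and U fixes their vectors
and lies in ker χ. -/
theorem exists_twistedSum_eq_zero {σ : Representation R N W} (hσ : IsSmooth σ) {χ : N →* Rˣ}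
    (hχ : IsSmoothChar χ) {w : W} (hw : w ∈ coinvKer σ χ) :
    ∃ C : Set N, IsCompact C ∧ ∃ U : OpenSubgroup N, ∀ (K : Subgroup N) (L : Subgroup K)
      [L.Normal] [Fintype (K ⧸ L)], C ⊆ K → (∀ l ∈ L, (l : N) ∈ U) → twistedSum σ χ L w = 0 := by
  induction hw using Submodule.span_induction with
  | mem x hx =>
    obtain ⟨n, w, rfl⟩ := hx
    obtain ⟨U, hU⟩ := hσ w
    refine ⟨{n}, isCompact_singleton, U ⊓ ⟨χ.ker, hχ⟩, fun K L _ _ hC hL => ?_⟩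
    exact twistedSum_sub_smul_eq_zero σ χ L (fun l hl => hU l (hL l hl).1)
      (fun l hl => (hL l hl).2) ⟨n, hC rfl⟩
  | zero => exact ⟨∅, isCompact_empty, ⊤, fun K L _ _ _ _ => map_zero _⟩
  | add x y _ _ hx hy =>
    obtain ⟨C, hC, U, h⟩ := hx
    obtain ⟨C', hC', U', h'⟩ := hy
    refine ⟨C ∪ C', hC.union hC', U ⊓ U', fun K L _ _ hCK hL => ?_⟩
    rw [map_add, h K L (Set.subset_union_left.trans hCK) fun l hl => (hL l hl).1,
      h' K L (Set.subset_union_right.trans hCK) fun l hl => (hL l hl).2, add_zero]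
  | smul a x _ hx =>
    obtain ⟨C, hC, U, h⟩ := hx
    refine ⟨C, hC, U, fun K L _ _ hCK hL => ?_⟩
    rw [map_smul, h K L hCK hL, smul_zero]

/-- Exactness of the coinvariants: an injective equivariant map into a smooth representation is
injective on coinvariants. -/
theorem mem_coinvKer_of_injective [IsTopologicalGroup N] (hN : IsExhausted R N) {σ : Representation R N W}
    {σ' : Representation R N W'} (hσ' : IsSmooth σ') {χ : N →* Rˣ} (hχ : IsSmoothChar χ)
    {T : W →ₗ[R] W'} (hT : Function.Injective T) (hTσ : ∀ n w, T (σ n w) = σ' n (T w)) {w : W}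
    (hw : T w ∈ coinvKer σ' χ) : w ∈ coinvKer σ χ := by
  obtain ⟨C, hC, U, hU⟩ := exists_twistedSum_eq_zero hσ' hχ hw
  obtain ⟨K, hCK, hK, hinv⟩ := hN C hC
  obtain ⟨S, hSU, hS⟩ := exists_openSubgroup_normalized hK U
  let L : Subgroup K := (S : Subgroup N).subgroupOf K
  have : L.Normal :=
    ⟨fun l hl k => Subgroup.mem_subgroupOf.2 (hS k k.2 l (Subgroup.mem_subgroupOf.1 hl))⟩
  have hunit : IsUnit (L.index : R) := hinv L (S.isOpen.preimage continuous_subtype_val)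
  have : L.FiniteIndex := ⟨fun h => by rw [h] at hunit; simp at hunit⟩
  let _ : Fintype (K ⧸ L) := Fintype.ofFinite _
  -- L is adapted to the smooth target. Injectivity of T carries the vanishing of the twisted sum
  -- back to w, and [K : L] is invertible.
  have h0 := hU K L hCK fun l hl => hSU hl
  have h1 : T (twistedSum σ χ L w) = twistedSum σ' χ L (T w) := by
    simp only [twistedSum_apply, map_sum, map_smul, hTσ]
  rw [h0, LinearMap.map_eq_zero_iff T hT] at h1
  have h2 := card_smul_sub_twistedSum_mem_coinvKer σ χ L w
  rw [h1, sub_zero, ← Nat.card_eq_fintype_card] at h2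
  exact (Submodule.smul_mem_iff _ hunit.ne_zero).1 h2

end Exactness

/-! ### Smoothness of [ωθ] for σ-compact N -/

section SigmaCompact

variable {R : Type*} [Field R] {G : Type*} [Group G] [TopologicalSpace G] [IsTopologicalGroup G]
  {ω : Subgroup.center G →* Rˣ} {N : Subgroup G} {θ : N →* Rˣ}
  {χ : ↥(Subgroup.center G ⊔ N) →* Rˣ}

theorem isClosed_center [T2Space G] : IsClosed (Subgroup.center G : Set G) := by
  have h := Set.isClosed_centralizer (Set.univ : Set G)
  rwa [Set.centralizer_univ] at h

theorem isOpenMap_toModCenter [T2Space G] [LocallyCompactSpace G]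
    (hM : IsClosed ((Subgroup.center G ⊔ N : Subgroup G) : Set G)) (hN : IsClosed (N : Set G))
    (hσ : IsSigmaCompact (N : Set G)) :
    IsOpenMap ((QuotientGroup.mk' ((Subgroup.center G).subgroupOf (Subgroup.center G ⊔ N))).comp
      (Subgroup.inclusion (le_sup_right : N ≤ Subgroup.center G ⊔ N))) := by
  have : SigmaCompactSpace N := isSigmaCompact_iff_sigmaCompactSpace.1 hσ
  have : LocallyCompactSpace N := hN.isClosedEmbedding_subtypeVal.locallyCompactSpace
  have : LocallyCompactSpace ↥(Subgroup.center G ⊔ N) :=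
    hM.isClosedEmbedding_subtypeVal.locallyCompactSpace
  have : IsClosed ((Subgroup.center G).subgroupOf (Subgroup.center G ⊔ N) :
      Set ↥(Subgroup.center G ⊔ N)) := isClosed_center.preimage continuous_subtype_val
  refine MonoidHom.isOpenMap_of_sigmaCompact _ (fun y => ?_)
    (QuotientGroup.continuous_mk.comp (continuous_subtype_val.subtype_mk _))
  obtain ⟨h, rfl⟩ := QuotientGroup.mk_surjective y
  obtain ⟨z, n, e⟩ := exists_center_mul h
  refine ⟨n, QuotientGroup.eq.2 ?_⟩
  rw [Subgroup.mem_subgroupOf]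
  have h1 : ((Subgroup.inclusion (le_sup_right : N ≤ Subgroup.center G ⊔ N) n)⁻¹ * h : G) = z := by
    rw [← e, ← Subgroup.mem_center_iff.1 z.2 n]
    exact inv_mul_cancel_left _ _
  exact Set.mem_of_eq_of_mem h1 z.2

/-- Openness of N → Z \ ZN makes ZN₁ open in ZN for N₁ = N ∩ K ∩ ker θ. Removing the closed set N₁ ·
(Z \ ker ω) leaves a neighbourhood of 1 inside ker χ. -/
theorem isSmoothChar_of_isSigmaCompact [T2Space G] [LocallyCompactSpace G]
    {K : OpenSubgroup G} (hK : IsCompact (K : Set G)) (hχ : ExtendsCentral ω χ)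
    (hθχ : ExtendsRight θ χ) (hω : IsSmoothChar ω) (hθ : IsSmoothChar θ)
    (hM : IsClosed ((Subgroup.center G ⊔ N : Subgroup G) : Set G)) (hN : IsClosed (N : Set G))
    (hσ : IsSigmaCompact (N : Set G)) : IsSmoothChar χ := by
  let N₁ : OpenSubgroup N := K.comap N.subtype continuous_subtype_val ⊓ ⟨θ.ker, hθ⟩
  have hN₁ : IsCompact (N₁ : Set N) :=
    (hN.isClosedEmbedding_subtypeVal.isCompact_preimage hK).of_isClosed_subset N₁.isClosed
      fun _ hx => hx.1
  let S : Set G := Subtype.val '' (N₁ : Set N)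
  let B : Set G := Subtype.val '' ((ω.ker : Set (Subgroup.center G))ᶜ)
  have hB : IsClosed B :=
    isClosed_center.isClosedEmbedding_subtypeVal.isClosedMap _ hω.isClosed_compl
  -- Compactness of N₁ is what makes this product closed.
  have hSB : IsClosed (S * B) := hB.mul_left_of_isCompact (hN₁.image continuous_subtype_val)
  have hO := (isOpenMap_toModCenter hM hN hσ _ N₁.isOpen).preimage
    (QuotientGroup.continuous_mk (N := (Subgroup.center G).subgroupOf (Subgroup.center G ⊔ N)))
  have hopen := hO.inter (hSB.isOpen_compl.preimage
    (continuous_subtype_val (p := fun x => x ∈ Subgroup.center G ⊔ N)))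
  refine Subgroup.isOpen_of_mem_nhds χ.ker (g := 1)
    (Filter.mem_of_superset (hopen.mem_nhds ⟨⟨1, N₁.one_mem, map_one _⟩, ?_⟩) ?_)
  · rintro ⟨_, ⟨n, hn, rfl⟩, _, ⟨z, hz, rfl⟩, e⟩
    refine hz ?_
    have h1 : (1 : Rˣ) = χ ⟨n, Subgroup.mem_sup_right n.2⟩ * χ ⟨z, Subgroup.mem_sup_left z.2⟩ := by
      rw [← map_mul, ← map_one χ]
      exact congrArg χ (Subtype.ext e.symm)
    rw [hχ, hθχ, show θ n = 1 from hn.2, one_mul] at h1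
    exact h1.symm
  · rintro h ⟨⟨n, hn, e⟩, hnot⟩
    have h1 := QuotientGroup.eq.1 e
    rw [Subgroup.mem_subgroupOf] at h1
    have h2 : h = ⟨n, Subgroup.mem_sup_right n.2⟩ * ⟨_, Subgroup.mem_sup_left h1⟩ :=
      Subtype.ext (mul_inv_cancel_left (n : G) h).symm
    change χ h = 1
    rw [h2, map_mul, hθχ, hχ ⟨_, h1⟩, show θ n = 1 from hn.2, one_mul]
    by_contra hne
    exact hnot ⟨n, ⟨n, hn, rfl⟩, _, ⟨⟨_, h1⟩, hne, rfl⟩, mul_inv_cancel_left (n : G) h⟩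

end SigmaCompact

/-! ### The coefficient map on coinvariants -/

section CoinvariantMap

variable {R : Type*} [Field R] {G : Type*} [Group G] [TopologicalSpace G] [IsTopologicalGroup G]
  {V : Type*} [AddCommGroup V] [Module R V] {π : Representation R G V}
  {ω : Subgroup.center G →* Rˣ} {N : Subgroup G} {θ : N →* Rˣ}
  {χ : ↥(Subgroup.center G ⊔ N) →* Rˣ}

theorem isSmoothChar_of_isCentralCharacter [Nontrivial V] (hsm : IsSmooth π)
    (hω : IsCentralCharacter π ω) : IsSmoothChar ω := by
  obtain ⟨v, hv⟩ := exists_ne (0 : V)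
  obtain ⟨U, hU⟩ := hsm v
  refine Subgroup.isOpen_mono (H₁ := (U : Subgroup G).subgroupOf _) (fun z hz => ?_)
    (U.isOpen.preimage continuous_subtype_val)
  have h1 := hU z hz
  rw [hω, ← sub_eq_zero] at h1
  have h2 : ((ω z : R) - 1) • v = 0 := by rw [sub_smul, one_smul, h1]
  exact Units.ext (sub_eq_zero.1 ((smul_eq_zero.1 h2).resolve_right hv))

theorem isSmooth_leftRep (hb : HasOpenSubgroupBasis G) : IsSmooth (leftRep ω N) := by
  intro f
  obtain ⟨U, hU⟩ := exists_left_invariant_of_mem_cInd hb f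
  refine ⟨U.comap N.subtype continuous_subtype_val, fun n hn => Subtype.ext (funext fun x => ?_)⟩
  rw [leftRep_apply]
  exact hU _ (U.inv_mem hn) x

/-- The linear map out of `(W ⧸ A) ⊗ V` induced by one out of `W ⊗ V` that kills `a ⊗ v` for
`a ∈ A`. -/
def quotTensorLift {W X : Type*} [AddCommGroup W] [Module R W] [AddCommGroup X] [Module R X]
    {A : Submodule R W} (F : W ⊗[R] V →ₗ[R] X) (hF : ∀ a ∈ A, ∀ v : V, F (a ⊗ₜ[R] v) = 0) :
    (W ⧸ A) ⊗[R] V →ₗ[R] X :=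
  TensorProduct.lift (A.liftQ (TensorProduct.curry F)
    fun a ha => LinearMap.ext fun v => hF a ha v)

theorem quotTensorLift_tmul {W X : Type*} [AddCommGroup W] [Module R W] [AddCommGroup X]
    [Module R X] {A : Submodule R W} (F : W ⊗[R] V →ₗ[R] X)
    (hF : ∀ a ∈ A, ∀ v : V, F (a ⊗ₜ[R] v) = 0) (w : W) (v : V) :
    quotTensorLift F hF (Submodule.Quotient.mk w ⊗ₜ[R] v) = F (w ⊗ₜ[R] v) := rfl

variable {W : Type*} [AddCommGroup W] [Module R W] {ι : W → ContragredientSpace π}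
  (hadd : ∀ ξ η, ι (ξ + η) = ι ξ + ι η) (hsmul : ∀ (a : R) ξ, ι (a • ξ) = a • ι ξ)
  (hsm : IsSmooth π) (hZc : IsZCompact π) (hω : IsCentralCharacter π ω)

theorem coeffLift_equivariant {σ : Representation R G W}
    (hισ : ∀ g ξ, ι (σ g ξ) = contragredient π g (ι ξ)) (n : N) (g : G) (ξ : W) (v : V) :
    coeffLift hadd hsmul hsm hZc hω (σ n ξ ⊗ₜ[R] π g v) =
      indCenterRep ω N (n, g) (coeffLift hadd hsmul hsm hZc hω (ξ ⊗ₜ[R] v)) := by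
  refine Subtype.ext (funext fun x => ?_)
  rw [coeffLift_tmul, coeffLift_tmul, coeffMap_tmul_apply, hισ, contragredient_apply,
    ← Module.End.mul_apply, ← Module.End.mul_apply, ← map_mul, ← map_mul]
  rfl

theorem coeffLift_eq_zero_of_mem_coinvKer {σ : Representation R G W}
    (hισ : ∀ g ξ, ι (σ g ξ) = contragredient π g (ι ξ))
    (q : (indCenterRep ω N).IntertwiningMap (indProdRep χ))
    (hq : LinearMap.ker q.toLinearMap = coinvKer (leftRep ω N) θ⁻¹)
    (ξ : W) (hξ : ξ ∈ coinvKer (σ.comp N.subtype) θ⁻¹) (v : V) :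
    (q.toLinearMap ∘ₗ coeffLift hadd hsmul hsm hZc hω) (ξ ⊗ₜ[R] v) = 0 := by
  induction hξ using Submodule.span_induction with
  | mem x hx =>
    obtain ⟨n, ξ, rfl⟩ := hx
    rw [LinearMap.comp_apply, TensorProduct.sub_tmul,
      ← TensorProduct.smul_tmul', map_sub, map_smul, ← LinearMap.mem_ker, hq]
    refine Submodule.subset_span ⟨n, coeffLift hadd hsmul hsm hZc hω (ξ ⊗ₜ[R] v), ?_⟩
    have := coeffLift_equivariant hadd hsmul hsm hZc hω hισ n 1 ξ v
    rw [map_one, Module.End.one_apply] at this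
    exact congrArg (· - _) this
  | zero => rw [TensorProduct.zero_tmul, map_zero]
  | add x y _ _ hx hy => rw [TensorProduct.add_tmul, map_add, hx, hy, add_zero]
  | smul a x _ hx => rw [← TensorProduct.smul_tmul', map_smul, hx, smul_zero]

variable {σ : Representation R G W} (hισ : ∀ g ξ, ι (σ g ξ) = contragredient π g (ι ξ))
  (q : (indCenterRep ω N).IntertwiningMap (indProdRep χ))
  (hq : LinearMap.ker q.toLinearMap = coinvKer (leftRep ω N) θ⁻¹)

/-- The map on the `θ⁻¹`-coinvariants of the contragredient induced by the coefficient map, for a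
morphism out of `ind_Z^G(ω)` that kills `ind_Z^G(ω)[θ⁻¹]`. -/
def coinvariantMap :
    Coinv (σ.comp N.subtype) θ⁻¹ ⊗[R] V →ₗ[R] cInd (Subgroup.center G ⊔ N) χ :=
  quotTensorLift (q.toLinearMap ∘ₗ coeffLift hadd hsmul hsm hZc hω)
    (coeffLift_eq_zero_of_mem_coinvKer hadd hsmul hsm hZc hω hισ q hq)

theorem coinvariantMap_tmul (ξ : W) (v : V) :
    coinvariantMap hadd hsmul hsm hZc hω hισ q hq (Submodule.Quotient.mk ξ ⊗ₜ[R] v) =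
      q (coeffLift hadd hsmul hsm hZc hω (ξ ⊗ₜ[R] v)) :=
  quotTensorLift_tmul _ _ ξ v

theorem coinvariantMap_equivariant (p : N × G) :
    coinvariantMap hadd hsmul hsm hZc hω hισ q hq ∘ₗ
        extTensor (coinvRep (σ.comp N.subtype) θ⁻¹) π p =
      indProdRep χ p ∘ₗ coinvariantMap hadd hsmul hsm hZc hω hισ q hq := by
  refine TensorProduct.ext' fun y v => ?_
  obtain ⟨ξ, rfl⟩ := Submodule.Quotient.mk_surjective _ y
  refine (coinvariantMap_tmul hadd hsmul hsm hZc hω hισ q hq (σ p.1 ξ) (π p.2 v)).trans ?_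
  rw [LinearMap.comp_apply, coinvariantMap_tmul, ← q.isIntertwining]
  exact congrArg q (coeffLift_equivariant hadd hsmul hsm hZc hω hισ p.1 p.2 ξ v)

theorem isSmoothChar_inv {H : Type*} [Group H] [TopologicalSpace H] {ψ : H →* Rˣ}
    (hψ : IsSmoothChar ψ) : IsSmoothChar ψ⁻¹ := by
  have : (ψ⁻¹).ker = ψ.ker := by
    ext n
    simp [MonoidHom.mem_ker]
  rw [IsSmoothChar, this]
  exact hψ

/-- H acts on W_ψ ⊗ V through ψ when V carries the trivial action, so the ψ-relations of W ⊗ V die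
there. -/
theorem rTensor_mkQ_eq_zero {H : Type*} [Group H] {τ : Representation R H W} {ψ : H →* Rˣ}
    {x : W ⊗[R] V} (hx : x ∈ coinvKer (τ.tprod (1 : Representation R H V)) ψ) :
    LinearMap.rTensor V (coinvKer τ ψ).mkQ x = 0 := by
  suffices h : coinvKer (τ.tprod (1 : Representation R H V)) ψ ≤
      LinearMap.ker (LinearMap.rTensor V (coinvKer τ ψ).mkQ) from h hx
  refine Submodule.span_le.2 ?_
  rintro _ ⟨n, w, rfl⟩
  rw [SetLike.mem_coe, LinearMap.mem_ker, map_sub, map_smul, sub_eq_zero]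
  have : LinearMap.rTensor V (coinvKer τ ψ).mkQ ∘ₗ τ.tprod (1 : Representation R H V) n =
      (ψ n : R) • LinearMap.rTensor V (coinvKer τ ψ).mkQ :=
    TensorProduct.ext' fun ξ v => by
      change (coinvKer τ ψ).mkQ (τ n ξ) ⊗ₜ[R] v = (ψ n : R) • ((coinvKer τ ψ).mkQ ξ ⊗ₜ[R] v)
      rw [TensorProduct.smul_tmul', ← map_smul]
      congr 1
      exact (Submodule.Quotient.eq _).2 (Submodule.subset_span ⟨n, ξ, rfl⟩)
  exact LinearMap.congr_fun this w

/-- Lift an element of the kernel to x in W ⊗ V. Its coefficient function lies in ker q, hence among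
the θ⁻¹-relations, and exactness together with injectivity of the coefficient map makes x itself a
relation. -/
theorem coinvariantMap_injective [IsAlgClosed R] (hirr : π.IsIrreducible)
    (hι : ∀ ξ, ι ξ = 0 → ξ = 0) (hb : HasOpenSubgroupBasis G) (hNex : IsExhausted R N)
    (hθ : IsSmoothChar θ) :
    Function.Injective (coinvariantMap hadd hsmul hsm hZc hω hισ q hq) := by
  rw [injective_iff_map_eq_zero]
  intro y hy
  obtain ⟨x, rfl⟩ := LinearMap.rTensor_surjective V
    (coinvKer (σ.comp N.subtype) θ⁻¹).mkQ_surjective y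
  have h1 : coinvariantMap hadd hsmul hsm hZc hω hισ q hq ∘ₗ
      LinearMap.rTensor V (coinvKer (σ.comp N.subtype) θ⁻¹).mkQ =
      q.toLinearMap ∘ₗ coeffLift hadd hsmul hsm hZc hω :=
    TensorProduct.ext' fun ξ v => coinvariantMap_tmul hadd hsmul hsm hZc hω hισ q hq ξ v
  have h2 : coeffLift hadd hsmul hsm hZc hω x ∈ coinvKer (leftRep ω N) θ⁻¹ := by
    rw [← hq, LinearMap.mem_ker]
    exact (LinearMap.congr_fun h1 x).symm.trans hy
  refine rTensor_mkQ_eq_zero (mem_coinvKer_of_injective hNex (isSmooth_leftRep hb)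
    (isSmoothChar_inv hθ) (coeffLift_injective hadd hsmul hsm hZc hω hirr hι) (fun n w => ?_) h2)
  have : coeffLift hadd hsmul hsm hZc hω ∘ₗ
      Representation.tprod (σ.comp N.subtype) (1 : Representation R N V) n =
      leftRep ω N n ∘ₗ coeffLift hadd hsmul hsm hZc hω := TensorProduct.ext' fun ξ v => by
    have := coeffLift_equivariant hadd hsmul hsm hZc hω hισ n 1 ξ v
    rw [map_one, Module.End.one_apply] at this
    exact this
  exact LinearMap.congr_fun this w

include hadd hsmul hισ hq in
theorem exists_coinvariant_intertwiningMap [IsAlgClosed R] (hirr : π.IsIrreducible)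
    (hι : ∀ ξ, ι ξ = 0 → ξ = 0) (hb : HasOpenSubgroupBasis G) (hNex : IsExhausted R N)
    (hθ : IsSmoothChar θ) :
    ∃ Φ : (extTensor (coinvRep (σ.comp N.subtype) θ⁻¹) π).IntertwiningMap (indProdRep χ),
      (∀ (ξ : W) (v : V), Φ (Submodule.Quotient.mk ξ ⊗ₜ[R] v) =
        q (coeffMap π hsm hZc ω hω (ι ξ ⊗ₜ[R] v))) ∧ Function.Injective Φ :=
  ⟨⟨coinvariantMap hadd hsmul hsm hZc hω hισ q hq,
    coinvariantMap_equivariant hadd hsmul hsm hZc hω hισ q hq⟩,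
    fun ξ v => (coinvariantMap_tmul hadd hsmul hsm hZc hω hισ q hq ξ v).trans
      (congrArg q (coeffLift_tmul hadd hsmul hsm hZc hω ξ v)),
    coinvariantMap_injective hadd hsmul hsm hZc hω hισ q hq hirr hι hb hNex hθ⟩

end CoinvariantMap

end SmoothRep

end

/-! ### The theorem -/

theorem mainTheorem8
    {R : Type*} [Field R] [IsAlgClosed R]
    {G : Type*} [Group G] [TopologicalSpace G] [IsTopologicalGroup G]
    [T2Space G] [LocallyCompactSpace G] [TotallyDisconnectedSpace G]
    (hG : ∃ K : Subgroup G, IsOpen (K : Set G) ∧ IsCompact (K : Set G) ∧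
      HasInvertibleProOrder R K)
    {V : Type*} [AddCommGroup V] [Module R V] (π : Representation R G V)
    (hsm : IsSmooth π) (hirr : π.IsIrreducible) (hZc : IsZCompact π)
    (ω : Subgroup.center G →* Rˣ) (hω : IsCentralCharacter π ω)
    (N : Subgroup G) (hN : IsClosed (N : Set G)) (hNex : IsExhausted R N)
    (θ : N →* Rˣ) (hθ : IsSmoothChar θ)
    (hagree : ∀ (g : G) (hZ : g ∈ Subgroup.center G) (hN : g ∈ N), ω ⟨g, hZ⟩ = θ ⟨g, hN⟩)
    (hZN : IsClosed ((Subgroup.center G ⊔ N : Subgroup G) : Set G)) :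
    (IsSigmaCompact (N : Set G) → IsSmoothChar (prodChar ω θ hagree)) ∧
    (∃ μ : locConstCc R (ModCenter N) →ₗ[R] R, IsHaar μ) ∧
    ∀ μ : locConstCc R (ModCenter N) →ₗ[R] R, IsHaar μ →
      ∃ (q : (indCenterRep ω N).IntertwiningMap (indProdRep (prodChar ω θ hagree)))
        (Φ : (extTensor (coinvRep ((contragredient π).comp N.subtype) θ⁻¹) π).IntertwiningMap
          (indProdRep (prodChar ω θ hagree))),
        -- `q` is integration along `Z \ Z N`
        (IsSmoothChar (prodChar ω θ hagree) →
          ∀ (f : cInd (Subgroup.center G) ω) (g : G), ∃ φ : locConstCc R (ModCenter N),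
            (∀ h : ↥(Subgroup.center G ⊔ N), (φ : ModCenter N → R) h =
              ((prodChar ω θ hagree h)⁻¹ : Rˣ) * (f : G → R) (h * g)) ∧
            (q f : G → R) g = μ φ) ∧
        -- `q` identifies its target with the `θ⁻¹`-coinvariants of its source for `λ`
        Function.Surjective q ∧
        LinearMap.ker q.toLinearMap =
          coinvKer ((indCenterRep ω N).comp (MonoidHom.inl N G)) θ⁻¹ ∧
        -- `Φ` is induced by the coefficient map through `q`, and is injective
        (∀ (ξ : ContragredientSpace π) (v : V),
          Φ (Submodule.Quotient.mk ξ ⊗ₜ[R] v) = q (coeffMap π hsm hZc ω hω (ξ ⊗ₜ[R] v))) ∧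
        Function.Injective Φ := by
  obtain ⟨K, hKo, hK, hKinv⟩ := hG
  have hb : HasOpenSubgroupBasis G := hasOpenSubgroupBasis_of_compact_open hKo hK
  have hinv : HasInvertibleIndices R K := hKinv.hasInvertibleIndices
  have hcent : ExtendsCentral ω (prodChar ω θ hagree) := fun z => by
    rw [prodChar_apply ω θ hagree z 1 _ (by simp), map_one, mul_one]
  have hright : ExtendsRight θ (prodChar ω θ hagree) := fun n => by
    rw [prodChar_apply ω θ hagree 1 n _ (by simp), map_one, one_mul]
  -- A nonzero vector is needed for smoothness of π to pass to ω.
  have : Nontrivial V := by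
    by_contra h
    rw [not_nontrivial_iff_subsingleton] at h
    have := hirr.toNontrivial
    obtain ⟨a, b, hab⟩ := exists_pair_ne (Subrepresentation π)
    exact hab (Subrepresentation.toSubmodule_injective (Subsingleton.elim _ _))
  have hbQ : HasOpenSubgroupBasis (ModCenter N) := (hb.subgroup _).quotient _
  -- The image of K ∩ ZN is the compact open subgroup of Z \ ZN that normalizes the Haar measure.
  have hKQ := isCompact_conjImage (N := N) (U := ⟨K, hKo⟩) hZN hK 1
  have hinvQ : HasInvertibleIndices R (conjImage N ⟨K, hKo⟩ 1 : Subgroup (ModCenter N)) :=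
    hasInvertibleIndices_conjImage (U := ⟨K, hKo⟩) hb hK hinv 1
  refine ⟨isSmoothChar_of_isSigmaCompact (K := ⟨K, hKo⟩) hK hcent hright
    (isSmoothChar_of_isCentralCharacter hsm hω) hθ hZN hN, exists_isHaar hbQ _ hKQ hinvQ,
    fun μ hμ => ?_⟩
  obtain ⟨q, hq, hqs, hqk⟩ := exists_integration_intertwiningMap (K := ⟨K, hKo⟩) hK hinv hb hcent
    hright hZN hNex hμ
  have hι : ∀ ξ : ContragredientSpace π, id ξ = 0 → ξ = 0 := fun _ h => h
  obtain ⟨Φ, hΦ, hΦi⟩ := exists_coinvariant_intertwiningMap (W := ContragredientSpace π) (ι := id)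
    (fun _ _ => rfl) (fun _ _ => rfl) hsm hZc hω (σ := contragredient π) (fun _ _ => rfl) q hqk hirr
    hι hb hNex hθ
  exact ⟨q, Φ, hq, hqs, hqk, hΦ, hΦi⟩
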